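/- Let $L_n$ be the linear graph $1\leftrightarrow 2\leftrightarrow\cdots\leftrightarrow n$ on $[n]=\{1,\dots,n\}$, each unoriented edge being identified with the two oriented edges, and let $E_0$ be its set of oriented edges. An oriented edge $i\to j$ is rightward if $i<j$ and leftward if $i>j$; its length is $|i-j|$, the distance from $i$ to $j$ in $L_n$. Given $p_{\mathrm{left}}=p_{\mathrm{left}}(n)$ and $p_{\mathrm{right}}=p_{\mathrm{right}}(n)$ in $[0,1]$, let $E_{\mathrm{open}}$ be the random set that contains, independently, each leftward edge not in $E_0$ with probability $p_{\mathrm{left}}$ and each rightward edge not in $E_0$ with probability $p_{\mathrm{right}}$ (and no self-loops). Define the sets of occupied edges by $$E_{t+1}=E_t\cup\{\,i\to j\in E_{\mathrm{open}} : i\to k\in E_t \text{ and } k\to j\in E_t \text{ for some } k\in[n]\,\},\qquad t\ge 0,$$ and $E_\infty=\bigcup_{t\ge 0}E_t$. Events hold asymptotically almost surely (a.a.s.) if their probabilities tend to $1$ as $n\to\infty$. Fix $\alpha>0$. Then there are constants $c,C\in(0,\infty)$ and $A\in(0,1)$, depending only on $\alpha$, such that for all sequences $p_{\mathrm{left}}(n),p_{\mathrm{right}}(n)\in[0,1]$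 the following hold, where the stated inequalities between the densities and functions of $n$ are required for all sufficiently large $n$. 1. If $\max\{p_{\mathrm{left}},p_{\mathrm{right}}\}<c\,\frac{1}{\sqrt{\log n}}$, then a.a.s. $E_\infty$ contains no edge of length greater than $\alpha\log n$. 2. If $p_{\mathrm{left}}<c\,\frac{1}{\sqrt{\log n}}$ and $p_{\mathrm{right}}>A$, then a.a.s. $E_\infty$ contains every open rightward edge of length greater than $\alpha\log n$, but no leftward edge of length greater than $\alpha\log n$. 3. If $\min\{p_{\mathrm{left}},p_{\mathrm{right}}\}>C\,\frac{\log\log n}{\sqrt{\log n}}$, then a.a.s. saturation occurs: $E_\infty=E_0\cup E_{\mathrm{open}}$. -/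

import Mathlib

open MeasureTheory ProbabilityTheory Filter Topology

namespace TransClosure

/-- One step of the dynamics: an open edge `i → j` becomes occupied if `i → k` and `k → j` are
occupied for some vertex `k`. The edge `i → j` is the pair `(i, j)`. -/
def step {V : Type*} (Eopen E : Set (V × V)) : Set (V × V) :=
  E ∪ {e | e ∈ Eopen ∧ ∃ k : V, (e.1, k) ∈ E ∧ (k, e.2) ∈ E}

/-- The set `E_t` of edges occupied at time `t`. -/
def occupiedAt {V : Type*} (E0 Eopen : Set (V × V)) : ℕ → Set (V × V)
  | 0 => E0
  | t + 1 => step Eopen (occupiedAt E0 Eopen t)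

/-- The set `E_∞` of eventually occupied edges. -/
def eventuallyOccupied {V : Type*} (E0 Eopen : Set (V × V)) : Set (V × V) :=
  ⋃ t : ℕ, occupiedAt E0 Eopen t

/-- The edges of the unoriented linear graph `L_n`, each in both directions. -/
def lineEdges (n : ℕ) : Set (Fin n × Fin n) :=
  {e | (SimpleGraph.pathGraph n).Adj e.1 e.2}

/-- The length of `i → j`: the number of edges on a shortest path from `i` to `j` in `L_n`. -/
noncomputable def edgeLength {n : ℕ} (e : Fin n × Fin n) : ℕ :=
  (SimpleGraph.pathGraph n).dist e.1 e.2

def IsRightward {n : ℕ} (e : Fin n × Fin n) : Prop := e.1 < e.2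

def IsLeftward {n : ℕ} (e : Fin n × Fin n) : Prop := e.2 < e.1

/-- A configuration: one coin for every ordered pair of vertices. -/
abbrev Config (n : ℕ) : Type := Fin n × Fin n → Bool

/-- The open edges of a configuration. Initially occupied edges and self-loops are never open;
their coins are ignored. -/
def openEdges {n : ℕ} (ω : Config n) : Set (Fin n × Fin n) :=
  {e | e ∉ lineEdges n ∧ e.1 ≠ e.2 ∧ ω e = true}

/-- The probability that the coin of `e` shows `true`: `pright` for rightward edges and `pleft` for
leftward edges (the value for self-loops is irrelevant). -/
noncomputable def edgeProb {n : ℕ} (pleft pright : unitInterval) (e : Fin n × Fin n) :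
    unitInterval :=
  if e.1 < e.2 then pright else pleft

/-- The law of the configuration: independent coins with the above probabilities. -/
noncomputable def law (n : ℕ) (pleft pright : unitInterval) : Measure (Config n) :=
  Measure.pi fun e : Fin n × Fin n => bernoulliMeasure true false (edgeProb pleft pright e)

/-- `E_∞` for the configuration `ω` started from `L_n`. -/
def finalEdges {n : ℕ} (ω : Config n) : Set (Fin n × Fin n) :=
  eventuallyOccupied (lineEdges n) (openEdges ω)

/-- The events `Ev n` hold asymptotically almost surely under the laws with densities `pleft n`
and `pright n`. -/
def AAS (pleft pright : ℕ → unitInterval) (Ev : ∀ n : ℕ, Set (Config n)) : Prop :=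
  Tendsto (fun n : ℕ => law n (pleft n) (pright n) (Ev n)) atTop (𝓝 1)

end TransClosure

/-!
Low density: lengths at most double in each step, so a leftward edge longer than `X` forces one of
length between `X` and `2 * X` in the first step that produces any. Traced back in time over a gap
`{k, k + 1}`, the edge above it is eventually joined from the edge `k + 1 → k` and one other, so
some vertex within distance `2 * X` sends edges to, or receives edges from, both `k` and `k + 1`. At
density `p` this has probability of order `p + X * p ^ 2`, which is small for `X ≤ α * log n` and
`p < c / √(log n)`; it happens at `X / 2` disjoint gaps almost independently, so a union bound over
the `n` positions applies.

High rightward density: fill the intervals starting at one vertex greedily from left to right and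
keep the maximal filled pieces on a stack. A piece stays on the stack only because of a closed edge,
so the number of endpoints with a stack of length at least two has exponential tails. An open edge
`i → j` that is not filled has no midpoint `k` with both `i → k` and `k → j` filled, hence many such
endpoints as seen from `i` or from `j`.

Saturation: let `R` be a saturated interval and `u` its vertex next to `w`. Occupation of edges into
`w` spreads from `u` along the edges between in-neighbours of `w`, so it reaches all of them unless
a cut of this random graph separates some of them from `u`. For `ℓ` vertices this has probability at
most `4 * ℓ * exp (-p ^ 2 * ℓ / 4)`. Growth therefore rarely stops once `p ^ 2 * ℓ` is large, and a
star of open edges of size about `log n / (4 * log (log n))`, which one of `√n` disjoint blocks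
contains, is a large enough nucleus.
-/

namespace TransClosure

/-! ### Independent coins -/

section Coins

variable {ι κ : Type*}

lemma dependsOn_coin (i : ι) (b : Bool) : DependsOn (fun ω : ι → Bool => ω i = b) {i} :=
  fun _ _ h => by simp only [h i rfl]

lemma dependsOn_forall_mem {T : Finset κ} {P : κ → (ι → Bool) → Prop} {s : κ → Set ι}
    (hP : ∀ k ∈ T, DependsOn (P k) (s k)) :
    DependsOn (fun ω => ∀ k ∈ T, P k ω) (⋃ k ∈ T, s k) := fun _ _ h =>
  propext <| forall₂_congr fun k hk => (hP k hk fun i hi => h i (Set.mem_biUnion hk hi)).to_iff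

variable [Fintype ι]

/-- The law of independent coins, the `i`-th of which shows `true` with probability `r i`; it
unfolds to `law` when the coins are the edges of `L_n`. -/
noncomputable def coinLaw (r : ι → unitInterval) : Measure (ι → Bool) :=
  Measure.pi fun i => bernoulliMeasure true false (r i)

instance (r : ι → unitInterval) : IsProbabilityMeasure (coinLaw r) := by
  unfold coinLaw; infer_instance

variable (r : ι → unitInterval)

lemma map_eval_coinLaw (i : ι) :
    (coinLaw r).map (fun ω => ω i) = bernoulliMeasure true false (r i) :=
  (measurePreserving_eval (fun i => bernoulliMeasure true false (r i)) i).map_eq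

lemma measureReal_coin (i : ι) (B : Set Bool) :
    (coinLaw r).real {ω | ω i ∈ B} = (bernoulliMeasure true false (r i)).real B := by
  rw [← map_eval_coinLaw r i, map_measureReal_apply (measurable_pi_apply i)
    B.toFinite.measurableSet]
  rfl

lemma measureReal_coin_true (i : ι) : (coinLaw r).real {ω | ω i = true} = r i := by
  simpa [bernoulliMeasure_def, measureReal_def] using measureReal_coin r i {true}

lemma measureReal_coin_false (i : ι) : (coinLaw r).real {ω | ω i = false} = 1 - r i := by
  simpa [bernoulliMeasure_def, measureReal_def] using measureReal_coin r i {false}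

lemma iIndepFun_coins : iIndepFun (fun (i : ι) (ω : ι → Bool) => ω i) (coinLaw r) :=
  iIndepFun_pi (X := fun (_ : ι) (b : Bool) => b) fun _ => by fun_prop

lemma map_coinLaw_comp [Fintype κ] {σ : κ → ι} (hσ : σ.Injective) :
    (coinLaw r).map (fun ω => ω ∘ σ) = coinLaw (r ∘ σ) := by
  have h := (iIndepFun_iff_map_fun_eq_pi_map
    fun k => (measurable_pi_apply (σ k)).aemeasurable).mp
    ((iIndepFun_coins r).precomp hσ)
  simp only [map_eval_coinLaw] at h
  exact h

lemma measureReal_comp [Fintype κ] {σ : κ → ι} (hσ : σ.Injective) (P : (κ → Bool) → Prop) :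
    (coinLaw r).real {ω | P (ω ∘ σ)} = (coinLaw (r ∘ σ)).real {ω | P ω} := by
  rw [← map_coinLaw_comp r hσ, map_measureReal_apply (measurable_of_finite _)
    (Set.toFinite _).measurableSet]
  rfl

lemma indepFun_of_dependsOn {β γ : Type*} [MeasurableSpace β] [MeasurableSpace γ]
    {X : (ι → Bool) → β} {Y : (ι → Bool) → γ} {s t : Set ι} (hst : Disjoint s t)
    (hX : DependsOn X s) (hY : DependsOn Y t) : IndepFun X Y (coinLaw r) := by
  classical
  have : Nonempty β := ⟨X fun _ => true⟩
  have : Nonempty γ := ⟨Y fun _ => true⟩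
  rw [← Set.coe_toFinset s, dependsOn_iff_exists_comp] at hX
  rw [← Set.coe_toFinset t, dependsOn_iff_exists_comp] at hY
  obtain ⟨F, rfl⟩ := hX
  obtain ⟨G, rfl⟩ := hY
  exact ((iIndepFun_coins r).indepFun_finset s.toFinset t.toFinset
    (Set.disjoint_toFinset.mpr hst) fun i => measurable_pi_apply i).comp
      (measurable_of_finite F) (measurable_of_finite G)

lemma measureReal_and_of_dependsOn {P Q : (ι → Bool) → Prop} {s t : Set ι}
    (hst : Disjoint s t) (hP : DependsOn P s) (hQ : DependsOn Q t) :
    (coinLaw r).real {ω | P ω ∧ Q ω} =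
      (coinLaw r).real {ω | P ω} * (coinLaw r).real {ω | Q ω} := by
  have h := (indepFun_of_dependsOn r hst hP hQ).measure_inter_preimage_eq_mul
    {True} {True} (measurableSet_singleton _) (measurableSet_singleton _)
  have hpre (R : (ι → Bool) → Prop) : R ⁻¹' {True} = {ω | R ω} := by ext; simp
  rw [hpre, hpre] at h
  simpa only [measureReal_def, ENNReal.toReal_mul, ← Set.ofPred_and] using
    congrArg ENNReal.toReal h

lemma integral_mul_of_dependsOn {f g : (ι → Bool) → ℝ} {s t : Set ι} (hst : Disjoint s t)
    (hf : DependsOn f s) (hg : DependsOn g t) :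
    ∫ ω, f ω * g ω ∂coinLaw r = (∫ ω, f ω ∂coinLaw r) * ∫ ω, g ω ∂coinLaw r :=
  (indepFun_of_dependsOn r hst hf hg).integral_fun_mul_eq_mul_integral
    (measurable_of_finite _).aestronglyMeasurable (measurable_of_finite _).aestronglyMeasurable

lemma measureReal_forall_of_dependsOn (T : Finset κ) {P : κ → (ι → Bool) → Prop}
    {s : κ → Set ι} (hs : (T : Set κ).PairwiseDisjoint s)
    (hP : ∀ k ∈ T, DependsOn (P k) (s k)) :
    (coinLaw r).real {ω | ∀ k ∈ T, P k ω} = ∏ k ∈ T, (coinLaw r).real {ω | P k ω} := by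
  classical
  induction T using Finset.induction_on with
  | empty => simp
  | insert a T ha ih =>
    have hT : ∀ k ∈ T, DependsOn (P k) (s k) := fun k hk => hP k (Finset.mem_insert_of_mem hk)
    have hdisj : Disjoint (s a) (⋃ k ∈ T, s k) := Set.disjoint_iUnion₂_right.mpr fun k hk =>
      hs (by simp) (by simp [hk]) (ne_of_mem_of_not_mem hk ha).symm
    rw [Finset.coe_insert] at hs
    rw [Finset.prod_insert ha, ← ih (hs.subset (Set.subset_insert _ _)) hT,
      ← measureReal_and_of_dependsOn r hdisj (hP a (Finset.mem_insert_self a T))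
        (dependsOn_forall_mem hT)]
    simp only [Finset.forall_mem_insert]

lemma measureReal_forall_le_pow (T : Finset κ) {P : κ → (ι → Bool) → Prop} {s : κ → Set ι}
    {δ : ℝ} (hs : (T : Set κ).PairwiseDisjoint s) (hP : ∀ k ∈ T, DependsOn (P k) (s k))
    (hδ : ∀ k ∈ T, (coinLaw r).real {ω | P k ω} ≤ δ) :
    (coinLaw r).real {ω | ∀ k ∈ T, P k ω} ≤ δ ^ T.card := by
  rw [measureReal_forall_of_dependsOn r T hs hP, ← Finset.prod_const]
  exact Finset.prod_le_prod (fun _ _ => measureReal_nonneg) hδ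

lemma measureReal_forall_coin_eq (T : Finset ι) (b : Bool) :
    (coinLaw r).real {ω | ∀ i ∈ T, ω i = b} = ∏ i ∈ T, (coinLaw r).real {ω | ω i = b} :=
  measureReal_forall_of_dependsOn r T (fun _ _ _ _ hij => by simpa using hij)
    fun i _ => dependsOn_coin i b

lemma measureReal_exists_le_sum (T : Finset κ) (P : κ → (ι → Bool) → Prop) :
    (coinLaw r).real {ω | ∃ k ∈ T, P k ω} ≤ ∑ k ∈ T, (coinLaw r).real {ω | P k ω} := by
  have h : {ω | ∃ k ∈ T, P k ω} = ⋃ k ∈ T, {ω | P k ω} := by ext; simp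
  exact h ▸ measureReal_biUnion_finset_le T _

lemma measureReal_mono_coins {P Q : (ι → Bool) → Prop} (h : ∀ ω, P ω → Q ω) :
    (coinLaw r).real {ω | P ω} ≤ (coinLaw r).real {ω | Q ω} :=
  measureReal_mono h

/-- Conditioning on the coins of `T` showing `true` amounts to biasing them completely. -/
lemma measureReal_forall_true_and [DecidableEq ι] (T : Finset ι) (P : (ι → Bool) → Prop) :
    (coinLaw r).real {ω | (∀ i ∈ T, ω i = true) ∧ P ω} =
      (∏ i ∈ T, (r i : ℝ)) * (coinLaw fun i => if i ∈ T then 1 else r i).real {ω | P ω} := by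
  let force (ω : ι → Bool) (i : ι) : Bool := if i ∈ T then true else ω i
  have hforce (ω : ι → Bool) (h : ∀ i ∈ T, ω i = true) : force ω = ω := by
    funext i
    by_cases hi : i ∈ T <;> simp [force, hi, h]
  have hmap : (coinLaw r).map force = coinLaw fun i => if i ∈ T then 1 else r i := by
    refine (Measure.pi_map_pi (μ := fun i => bernoulliMeasure true false (r i))
      (f := fun i b => if i ∈ T then true else b)
      (hf := fun i => (measurable_of_finite _).aemeasurable)).trans ?_
    refine congrArg Measure.pi (funext fun i => ?_)
    by_cases hi : i ∈ T <;> simp [hi]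
  calc (coinLaw r).real {ω | (∀ i ∈ T, ω i = true) ∧ P ω}
      = (coinLaw r).real {ω | (∀ i ∈ T, ω i = true) ∧ P (force ω)} :=
        congrArg _ (Set.ext fun ω => and_congr_right fun h => by rw [hforce ω h])
    _ = (coinLaw r).real {ω | ∀ i ∈ T, ω i = true} * (coinLaw r).real {ω | P (force ω)} := by
        refine measureReal_and_of_dependsOn r (s := (T : Set ι)) (t := (T : Set ι)ᶜ)
          disjoint_compl_right ?_ fun ω ω' h => congrArg P (funext fun i => ?_)
        · exact fun ω ω' h => propext (forall₂_congr fun i hi => by rw [h i hi])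
        · by_cases hi : i ∈ T
          · simp [force, hi]
          · simp [force, hi, h i hi]
    _ = _ := by
        rw [measureReal_forall_coin_eq, ← hmap, map_measureReal_apply (measurable_of_finite _)
          (Set.toFinite _).measurableSet]
        simp only [measureReal_coin_true]
        rfl

end Coins

/-! ### The dynamics on the line -/

section Dynamics

variable {V : Type*} {E0 Eo : Set (V × V)}

lemma monotone_occupiedAt : Monotone (occupiedAt E0 Eo) :=
  monotone_nat_of_le_succ fun _ => Set.subset_union_left

lemma occupiedAt_subset_union (t : ℕ) : occupiedAt E0 Eo t ⊆ E0 ∪ Eo := by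
  induction t with
  | zero => exact Set.subset_union_left
  | succ t ih => exact Set.union_subset ih fun e he => Or.inr he.1

lemma eventuallyOccupied_subset_union : eventuallyOccupied E0 Eo ⊆ E0 ∪ Eo :=
  Set.iUnion_subset occupiedAt_subset_union

lemma subset_eventuallyOccupied : E0 ⊆ eventuallyOccupied E0 Eo :=
  Set.subset_iUnion (occupiedAt E0 Eo) 0

lemma eventuallyOccupied_join {x k y : V} (h : (x, y) ∈ E0 ∪ Eo)
    (h1 : (x, k) ∈ eventuallyOccupied E0 Eo) (h2 : (k, y) ∈ eventuallyOccupied E0 Eo) :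
    (x, y) ∈ eventuallyOccupied E0 Eo := by
  rcases h with h | h
  · exact subset_eventuallyOccupied h
  obtain ⟨s, hs⟩ := Set.mem_iUnion.mp h1
  obtain ⟨t, ht⟩ := Set.mem_iUnion.mp h2
  exact Set.mem_iUnion.mpr ⟨max s t + 1, Or.inr ⟨h, k,
    monotone_occupiedAt (le_max_left s t) hs, monotone_occupiedAt (le_max_right s t) ht⟩⟩

lemma occupiedAt_preimage_swap (t : ℕ) :
    occupiedAt (Prod.swap ⁻¹' E0) (Prod.swap ⁻¹' Eo) t = Prod.swap ⁻¹' occupiedAt E0 Eo t := by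
  induction t with
  | zero => rfl
  | succ t ih =>
    ext ⟨x, y⟩
    simp only [occupiedAt, step, ih, Set.mem_union, Set.mem_preimage, Set.mem_ofPred_eq,
      Prod.swap_prod_mk, and_comm]

lemma eventuallyOccupied_preimage_swap :
    eventuallyOccupied (Prod.swap ⁻¹' E0) (Prod.swap ⁻¹' Eo) =
      Prod.swap ⁻¹' eventuallyOccupied E0 Eo := by
  simp only [eventuallyOccupied, occupiedAt_preimage_swap, Set.preimage_iUnion]

end Dynamics

section Line

variable {n : ℕ}

lemma mem_lineEdges {e : Fin n × Fin n} :
    e ∈ lineEdges n ↔ e.1.val + 1 = e.2.val ∨ e.2.val + 1 = e.1.val :=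
  SimpleGraph.pathGraph_adj

lemma preimage_swap_lineEdges : Prod.swap ⁻¹' lineEdges n = lineEdges n :=
  Set.ext fun e => SimpleGraph.adj_comm (SimpleGraph.pathGraph n) e.2 e.1

lemma openEdges_comp_swap (ω : Config n) :
    openEdges (ω ∘ Prod.swap) = Prod.swap ⁻¹' openEdges ω := by
  rw [openEdges, ← preimage_swap_lineEdges]
  exact Set.ext fun e => and_congr_right fun _ => and_congr_left fun _ => ne_comm

lemma finalEdges_comp_swap (ω : Config n) :
    finalEdges (ω ∘ Prod.swap) = Prod.swap ⁻¹' finalEdges ω := by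
  rw [finalEdges, openEdges_comp_swap, ← preimage_swap_lineEdges,
    eventuallyOccupied_preimage_swap, finalEdges]

lemma finalEdges_subset (ω : Config n) : finalEdges ω ⊆ lineEdges n ∪ openEdges ω :=
  eventuallyOccupied_subset_union

lemma lineEdges_subset_finalEdges (ω : Config n) : lineEdges n ⊆ finalEdges ω :=
  subset_eventuallyOccupied

lemma mem_lineEdges_union_openEdges {ω : Config n} {x y : Fin n} (hxy : x ≠ y)
    (h : ω (x, y) = true) : (x, y) ∈ lineEdges n ∪ openEdges ω :=
  or_iff_not_imp_left.mpr fun hl => ⟨hl, hxy, h⟩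

lemma mem_finalEdges_of_join {ω : Config n} {x k y : Fin n} (hxy : x ≠ y)
    (h : ω (x, y) = true) (h1 : (x, k) ∈ finalEdges ω) (h2 : (k, y) ∈ finalEdges ω) :
    (x, y) ∈ finalEdges ω :=
  eventuallyOccupied_join (mem_lineEdges_union_openEdges hxy h) h1 h2

lemma le_add_length_of_walk {x y : Fin n} (w : (SimpleGraph.pathGraph n).Walk x y) :
    y.val ≤ x.val + w.length := by
  induction w with
  | nil => simp
  | cons h _ ih =>
    have := SimpleGraph.pathGraph_adj.mp h
    simp only [SimpleGraph.Walk.length_cons]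
    omega

lemma exists_walk_of_add_eq (d : ℕ) (x y : Fin n) (h : x.val + d = y.val) :
    ∃ w : (SimpleGraph.pathGraph n).Walk x y, w.length = d := by
  induction d generalizing x with
  | zero =>
    obtain rfl : x = y := Fin.ext h
    exact ⟨.nil, rfl⟩
  | succ d ih =>
    obtain ⟨w, hw⟩ := ih ⟨x.val + 1, by omega⟩ (by simp only; omega)
    exact ⟨.cons (SimpleGraph.pathGraph_adj.mpr (Or.inl rfl)) w, by simp [hw]⟩

lemma edgeLength_of_le {x y : Fin n} (h : x ≤ y) : edgeLength (x, y) = y.val - x.val := by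
  obtain ⟨w, hw⟩ := exists_walk_of_add_eq (y.val - x.val) x y (Nat.add_sub_of_le h)
  refine le_antisymm (hw ▸ SimpleGraph.dist_le w) ?_
  obtain ⟨v, hv⟩ := (SimpleGraph.pathGraph_preconnected n x y).exists_walk_length_eq_dist
  exact (Nat.sub_le_iff_le_add'.mpr (le_add_length_of_walk v)).trans_eq hv

lemma edgeLength_swap (e : Fin n × Fin n) : edgeLength e.swap = edgeLength e :=
  SimpleGraph.dist_comm

end Line

/-! ### Long edges need good gaps -/

section Gaps

variable {n : ℕ}

/-- Some vertex to the left of the gap between the neighbours `k < l`, at distance at most `M`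
from `l`, receives edges from both of them; the edge from `k` may be an edge of `L_n`. -/
def LeftGood (ω : Config n) (M : ℕ) (k l : Fin n) : Prop :=
  ∃ j < k, l.val ≤ j.val + M ∧ ω (l, j) = true ∧ (ω (k, j) = true ∨ j.val + 1 = k.val)

/-- The mirror image of `LeftGood`: some vertex to the right of the gap sends edges to both `k`
and `l`. -/
def RightGood (ω : Config n) (M : ℕ) (k l : Fin n) : Prop :=
  ∃ i > l, i.val ≤ k.val + M ∧ ω (i, k) = true ∧ (ω (i, l) = true ∨ l.val + 1 = i.val)

lemma mem_lineEdges_or_coin_of_mem_occupiedAt {ω : Config n} {t : ℕ} {x y : Fin n}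
    (h : (x, y) ∈ occupiedAt (lineEdges n) (openEdges ω) t) :
    (x.val + 1 = y.val ∨ y.val + 1 = x.val) ∨ ω (x, y) = true :=
  (occupiedAt_subset_union t h).imp mem_lineEdges.mp fun h => h.2.2

/-- Follow the edge over the gap `k, l` back in time while it keeps length at least two. When this
stops, the edge has been joined from the edge `l → k` and one other. -/
lemma leftGood_or_rightGood_of_mem_occupiedAt {ω : Config n} {M t : ℕ}
    (hM : ∀ e ∈ occupiedAt (lineEdges n) (openEdges ω) t, e.1.val ≤ e.2.val + M)
    {x y k l : Fin n} (he : (x, y) ∈ occupiedAt (lineEdges n) (openEdges ω) t)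
    (hkl : k.val + 1 = l.val) (hy : y ≤ k) (hx : l ≤ x) (hlen : y.val + 2 ≤ x.val) :
    LeftGood ω M k l ∨ RightGood ω M k l := by
  induction t generalizing x y with
  | zero =>
    have := mem_lineEdges.mp he
    simp only at this
    omega
  | succ t ih =>
    have ih {x y : Fin n} := ih (x := x) (y := y) fun e he => hM e (Or.inl he)
    have hMe : x.val ≤ y.val + M := hM _ he
    rcases id he with he' | ⟨hopen, m, (hxm : (x, m) ∈ _), (hmy : (m, y) ∈ _)⟩
    · exact ih he' hy hx hlen
    by_cases hleft : m ≤ k ∧ m.val + 2 ≤ x.val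
    · exact ih hxm hleft.1 hx hleft.2
    by_cases hright : l ≤ m ∧ y.val + 2 ≤ m.val
    · exact ih hmy hy hright.1 hright.2
    rcases le_or_gt m k with hmk | hmk
    · obtain ⟨rfl, rfl⟩ : m = k ∧ x = l := by omega
      refine Or.inl ⟨y, by omega, hMe, hopen.2.2, ?_⟩
      exact (mem_lineEdges_or_coin_of_mem_occupiedAt hmy).symm.imp_right fun h => by omega
    · obtain ⟨rfl, rfl⟩ : m = l ∧ y = k := by omega
      refine Or.inr ⟨x, by omega, hMe, hopen.2.2, ?_⟩
      exact (mem_lineEdges_or_coin_of_mem_occupiedAt hxm).symm.imp_right fun h => by omega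

lemma le_add_two_mul_of_mem_occupiedAt_succ {E : Set (Fin n × Fin n)} {X t : ℕ}
    (hX : ∀ e ∈ occupiedAt (lineEdges n) E t, e.1.val ≤ e.2.val + X)
    {e : Fin n × Fin n} (he : e ∈ occupiedAt (lineEdges n) E (t + 1)) :
    e.1.val ≤ e.2.val + 2 * X := by
  rcases he with he | ⟨-, m, h1, h2⟩
  · have := hX e he
    omega
  · have := hX _ h1
    have := hX _ h2
    simp only at *
    omega

/-- Lengths at most double in each step, so the first leftward edges longer than `X` have length
at most `2 * X`. -/
lemma exists_forall_gap_good {X : ℕ} (hX : 1 ≤ X) {ω : Config n} {e : Fin n × Fin n}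
    (he : e ∈ finalEdges ω) (hlen : e.2.val + X < e.1.val) :
    ∃ y : Fin n, y.val + X + 1 < n ∧ ∀ k l : Fin n, k.val + 1 = l.val → y ≤ k →
      k.val ≤ y.val + X → LeftGood ω (2 * X) k l ∨ RightGood ω (2 * X) k l := by
  classical
  have hex : ∃ t, ∃ e ∈ occupiedAt (lineEdges n) (openEdges ω) t, e.2.val + X < e.1.val := by
    obtain ⟨t, ht⟩ := Set.mem_iUnion.mp he
    exact ⟨t, e, ht, hlen⟩
  obtain ⟨⟨x, y⟩, hxy, hl⟩ := Nat.find_spec hex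
  have hshort (s : ℕ) (hs : s < Nat.find hex) (e : Fin n × Fin n)
      (he : e ∈ occupiedAt (lineEdges n) (openEdges ω) s) : e.1.val ≤ e.2.val + X :=
    not_lt.mp fun h => Nat.find_min hex hs ⟨e, he, h⟩
  have hM : ∀ e ∈ occupiedAt (lineEdges n) (openEdges ω) (Nat.find hex),
      e.1.val ≤ e.2.val + 2 * X := by
    intro e he
    rcases ht : Nat.find hex with _ | s
    · rw [ht] at he
      have := mem_lineEdges.mp he
      omega
    · rw [ht] at he
      exact le_add_two_mul_of_mem_occupiedAt_succ (hshort s (by omega)) he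
  simp only at hl
  exact ⟨y, by omega, fun k l hkl hyk hky =>
    leftGood_or_rightGood_of_mem_occupiedAt hM hxy hkl hyk (Fin.le_def.mpr (by omega)) (by omega)⟩

lemma dependsOn_leftGood (M : ℕ) (k l : Fin n) :
    DependsOn (fun ω => LeftGood ω M k l) (Prod.fst ⁻¹' {k, l}) := fun ω ω' h =>
  propext <| exists_congr fun j => by rw [h (l, j) (by simp), h (k, j) (by simp)]

lemma dependsOn_rightGood (M : ℕ) (k l : Fin n) :
    DependsOn (fun ω => RightGood ω M k l) (Prod.snd ⁻¹' {k, l}) := fun ω ω' h =>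
  propext <| exists_congr fun i => by rw [h (i, k) (by simp), h (i, l) (by simp)]

end Gaps

section GapProbability

variable {ι κ : Type*} [Fintype ι] {r : ι → unitInterval} {p : ℝ}

lemma measureReal_two_coins_le {a b : ι} (hab : a ≠ b) (hp : 0 ≤ p) (ha : (r a : ℝ) ≤ p)
    (hb : (r b : ℝ) ≤ p) : (coinLaw r).real {ω | ω a = true ∧ ω b = true} ≤ p ^ 2 := by
  rw [measureReal_and_of_dependsOn r (by simpa using hab) (dependsOn_coin a true)
    (dependsOn_coin b true), measureReal_coin_true, measureReal_coin_true, sq]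
  exact mul_le_mul ha hb (r b).2.1 hp

lemma measureReal_exists_pair_le {J : Finset κ} {a b : κ → ι} {D : κ → Prop} (hp : 0 ≤ p)
    (hab : ∀ j ∈ J, a j ≠ b j) (ha : ∀ j ∈ J, (r (a j) : ℝ) ≤ p)
    (hb : ∀ j ∈ J, (r (b j) : ℝ) ≤ p) (hD : ∀ i j, D i → D j → i = j) :
    (coinLaw r).real {ω | ∃ j ∈ J, ω (a j) = true ∧ (ω (b j) = true ∨ D j)} ≤
      p + J.card * p ^ 2 := by
  classical
  have hsplit : {ω : ι → Bool | ∃ j ∈ J, ω (a j) = true ∧ (ω (b j) = true ∨ D j)} ⊆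
      {ω | ∃ j ∈ J.filter D, ω (a j) = true} ∪
        {ω | ∃ j ∈ J, ω (a j) = true ∧ ω (b j) = true} := by
    rintro ω ⟨j, hj, haj, hbj | hDj⟩
    · exact Or.inr ⟨j, hj, haj, hbj⟩
    · exact Or.inl ⟨j, Finset.mem_filter.mpr ⟨hj, hDj⟩, haj⟩
  have hcard : (J.filter D).card ≤ 1 := Finset.card_le_one.mpr fun i hi j hj =>
    hD i j (Finset.mem_filter.mp hi).2 (Finset.mem_filter.mp hj).2
  have hsingle : (coinLaw r).real {ω | ∃ j ∈ J.filter D, ω (a j) = true} ≤ p :=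
    calc _ ≤ ∑ j ∈ J.filter D, (r (a j) : ℝ) := by
          simpa only [measureReal_coin_true] using
            measureReal_exists_le_sum r (J.filter D) fun j ω => ω (a j) = true
      _ ≤ (J.filter D).card * p := by
          simpa using Finset.sum_le_card_nsmul _ _ p fun j hj => ha j (Finset.mem_filter.mp hj).1
      _ ≤ p := mul_le_of_le_one_left hp (mod_cast hcard)
  have hpair : (coinLaw r).real {ω | ∃ j ∈ J, ω (a j) = true ∧ ω (b j) = true} ≤
      J.card * p ^ 2 :=
    (measureReal_exists_le_sum r J _).trans <| by
      simpa using Finset.sum_le_card_nsmul _ _ (p ^ 2) fun j hj =>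
        measureReal_two_coins_le (hab j hj) hp (ha j hj) (hb j hj)
  exact (measureReal_mono hsplit).trans <|
    (measureReal_union_le _ _).trans (add_le_add hsingle hpair)

end GapProbability

section LongLeftward

variable {n : ℕ} {r : Fin n × Fin n → unitInterval} {p η : ℝ} {M : ℕ}

lemma card_le_of_val_mem_Ico {J : Finset (Fin n)} {a b : ℕ}
    (hJ : ∀ j ∈ J, j.val ∈ Finset.Ico a b) : J.card ≤ b - a :=
  (Finset.card_le_card_of_injOn Fin.val hJ Fin.val_injective.injOn).trans_eq (Nat.card_Ico a b)

lemma measureReal_leftGood_le (hr : ∀ e, IsLeftward e → (r e : ℝ) ≤ p) (hp : 0 ≤ p)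
    {k l : Fin n} (hkl : k < l) :
    (coinLaw r).real {ω | LeftGood ω M k l} ≤ p + M * p ^ 2 := by
  let J : Finset (Fin n) := {j | j < k ∧ l.val ≤ j.val + M}
  have hJ {j : Fin n} (hj : j ∈ J) : j < k ∧ l.val ≤ j.val + M := (Finset.mem_filter.mp hj).2
  have hcard : J.card ≤ M := (card_le_of_val_mem_Ico (a := l.val - M) (b := l.val) fun j hj =>
    Finset.mem_Ico.mpr (by have := hJ hj; omega)).trans (by omega)
  calc (coinLaw r).real {ω | LeftGood ω M k l}
      ≤ (coinLaw r).real {ω | ∃ j ∈ J, ω (l, j) = true ∧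
          (ω (k, j) = true ∨ j.val + 1 = k.val)} :=
        measureReal_mono_coins r fun ω ⟨j, hjk, hlj, h⟩ => ⟨j, by simp [J, hjk, hlj], h⟩
    _ ≤ p + J.card * p ^ 2 := measureReal_exists_pair_le hp
        (fun j _ h => hkl.ne' (Prod.ext_iff.mp h).1) (fun j hj => hr _ ((hJ hj).1.trans hkl))
        (fun j hj => hr _ (hJ hj).1) fun i j hi hj => Fin.ext (by omega)
    _ ≤ p + M * p ^ 2 := by gcongr

lemma measureReal_rightGood_le (hr : ∀ e, IsLeftward e → (r e : ℝ) ≤ p) (hp : 0 ≤ p)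
    {k l : Fin n} (hkl : k < l) :
    (coinLaw r).real {ω | RightGood ω M k l} ≤ p + M * p ^ 2 := by
  let J : Finset (Fin n) := {i | l < i ∧ i.val ≤ k.val + M}
  have hJ {i : Fin n} (hi : i ∈ J) : l < i ∧ i.val ≤ k.val + M := (Finset.mem_filter.mp hi).2
  have hcard : J.card ≤ M := (card_le_of_val_mem_Ico (a := k.val + 1) (b := k.val + M + 1)
    fun i hi => Finset.mem_Ico.mpr (by have := hJ hi; omega)).trans (by omega)
  calc (coinLaw r).real {ω | RightGood ω M k l}
      ≤ (coinLaw r).real {ω | ∃ i ∈ J, ω (i, k) = true ∧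
          (ω (i, l) = true ∨ l.val + 1 = i.val)} :=
        measureReal_mono_coins r fun ω ⟨i, hli, hik, h⟩ => ⟨i, by simp [J, hli, hik], h⟩
    _ ≤ p + J.card * p ^ 2 := measureReal_exists_pair_le hp
        (fun i _ h => hkl.ne (Prod.ext_iff.mp h).2) (fun i hi => hr _ (hkl.trans (hJ hi).1))
        (fun i hi => hr _ (hJ hi).1) fun i j hi hj => Fin.ext (by omega)
    _ ≤ p + M * p ^ 2 := by gcongr

/-- An edge may serve one gap as a left edge and another one as a right edge, so the gaps are not
independent. The left goodness of disjoint gaps is, however, and so is the right goodness, and one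
of the two holds for at least half of the gaps. -/
lemma measureReal_forall_good_le {κ : Type*} (hr : ∀ e, IsLeftward e → (r e : ℝ) ≤ p)
    (hp : 0 ≤ p) (hη0 : 0 ≤ η) (hη1 : η ≤ 1) (hη : p + M * p ^ 2 ≤ η ^ 2) (H : Finset κ)
    {k l : κ → Fin n} (hkl : ∀ h ∈ H, k h < l h)
    (hdisj : (H : Set κ).PairwiseDisjoint fun h => ({k h, l h} : Set (Fin n))) :
    (coinLaw r).real {ω | ∀ h ∈ H, LeftGood ω M (k h) (l h) ∨ RightGood ω M (k h) (l h)} ≤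
      (2 * η) ^ H.card := by
  classical
  have hleft (T : Finset κ) (hT : T ⊆ H) :
      (coinLaw r).real {ω | ∀ h ∈ T, LeftGood ω M (k h) (l h)} ≤ (η ^ 2) ^ T.card :=
    measureReal_forall_le_pow r T (s := fun h => Prod.fst ⁻¹' {k h, l h})
      (fun i hi j hj hij => (hdisj (hT hi) (hT hj) hij).preimage _)
      (fun h _ => dependsOn_leftGood M _ _)
      fun h hh => (measureReal_leftGood_le hr hp (hkl h (hT hh))).trans hη
  have hright (T : Finset κ) (hT : T ⊆ H) :
      (coinLaw r).real {ω | ∀ h ∈ T, RightGood ω M (k h) (l h)} ≤ (η ^ 2) ^ T.card :=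
    measureReal_forall_le_pow r T (s := fun h => Prod.snd ⁻¹' {k h, l h})
      (fun i hi j hj hij => (hdisj (hT hi) (hT hj) hij).preimage _)
      (fun h _ => dependsOn_rightGood M _ _)
      fun h hh => (measureReal_rightGood_le hr hp (hkl h (hT hh))).trans hη
  have hpow {m : ℕ} (hm : H.card ≤ 2 * m) : (η ^ 2) ^ m ≤ η ^ H.card :=
    (pow_mul η 2 m).symm.trans_le (pow_le_pow_of_le_one hη0 hη1 hm)
  calc _ ≤ (coinLaw r).real {ω | ∃ T ∈ H.powerset, (∀ h ∈ T, LeftGood ω M (k h) (l h)) ∧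
          ∀ h ∈ H \ T, RightGood ω M (k h) (l h)} := by
        refine measureReal_mono_coins r fun ω hω =>
          ⟨H.filter fun h => LeftGood ω M (k h) (l h), by simp, by simp, fun h hh => ?_⟩
        simp only [Finset.mem_sdiff, Finset.mem_filter, not_and] at hh
        exact (hω h hh.1).resolve_left (hh.2 hh.1)
    _ ≤ ∑ T ∈ H.powerset, (coinLaw r).real {ω | (∀ h ∈ T, LeftGood ω M (k h) (l h)) ∧
          ∀ h ∈ H \ T, RightGood ω M (k h) (l h)} := measureReal_exists_le_sum r _ _
    _ ≤ ∑ _T ∈ H.powerset, η ^ H.card := by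
        refine Finset.sum_le_sum fun T hT => ?_
        have hTH := Finset.mem_powerset.mp hT
        have hcard := Finset.card_sdiff_add_card_eq_card hTH
        rcases le_total H.card (2 * T.card) with h | h
        · exact (measureReal_mono_coins r fun ω => And.left).trans ((hleft T hTH).trans (hpow h))
        · exact (measureReal_mono_coins r fun ω => And.right).trans
            ((hright _ Finset.sdiff_subset).trans (hpow (by omega)))
    _ = (2 * η) ^ H.card := by
        rw [Finset.sum_const, Finset.card_powerset, nsmul_eq_mul, mul_pow]
        norm_num

lemma measureReal_forall_gap_good_le (hr : ∀ e, IsLeftward e → (r e : ℝ) ≤ p) (hp : 0 ≤ p)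
    (hη0 : 0 ≤ η) (hη1 : η ≤ 1) (hη : p + M * p ^ 2 ≤ η ^ 2) {y X : ℕ} (hy : y + X < n) :
    (coinLaw r).real {ω | ∀ k l : Fin n, k.val + 1 = l.val → y ≤ k.val → k.val < y + X →
      LeftGood ω M k l ∨ RightGood ω M k l} ≤ (2 * η) ^ (X / 2) := by
  let k (h : Fin (X / 2)) : Fin n := ⟨y + 2 * h, by omega⟩
  let l (h : Fin (X / 2)) : Fin n := ⟨y + 2 * h + 1, by omega⟩
  have hdisj : ((Finset.univ : Finset (Fin (X / 2))) : Set (Fin (X / 2))).PairwiseDisjoint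
      fun h => ({k h, l h} : Set (Fin n)) := by
    intro i _ j _ hij
    rw [Function.onFun, Set.disjoint_left]
    simp only [k, l, Set.mem_insert_iff, Set.mem_singleton_iff, Fin.ext_iff]
    omega
  calc _ ≤ (coinLaw r).real {ω | ∀ h ∈ (Finset.univ : Finset (Fin (X / 2))),
          LeftGood ω M (k h) (l h) ∨ RightGood ω M (k h) (l h)} :=
        measureReal_mono_coins r fun ω hω h _ =>
          hω (k h) (l h) rfl (Nat.le_add_right _ _) (by simp only [k]; omega)
    _ ≤ (2 * η) ^ (X / 2) := by
        simpa only [Finset.card_univ, Fintype.card_fin] using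
          measureReal_forall_good_le hr hp hη0 hη1 hη Finset.univ
            (fun h _ => Fin.mk_lt_mk.mpr (Nat.lt_succ_self _)) hdisj

lemma measureReal_exists_long_leftward_le (hr : ∀ e, IsLeftward e → (r e : ℝ) ≤ p) (hp : 0 ≤ p)
    (hη0 : 0 ≤ η) (hη1 : η ≤ 1) {X : ℕ} (hX : 1 ≤ X) (hη : p + (2 * X : ℕ) * p ^ 2 ≤ η ^ 2) :
    (coinLaw r).real {ω | ∃ e ∈ finalEdges ω, IsLeftward e ∧ X < edgeLength e} ≤
      n * (2 * η) ^ (X / 2) := by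
  let start : Finset (Fin n) := {y | y.val + X + 1 < n}
  calc _ ≤ (coinLaw r).real {ω | ∃ y ∈ start, ∀ k l : Fin n, k.val + 1 = l.val → y.val ≤ k.val →
          k.val < y.val + X → LeftGood ω (2 * X) k l ∨ RightGood ω (2 * X) k l} := by
        refine measureReal_mono_coins r fun ω ⟨⟨x, y⟩, he, (hyx : y < x), hlen⟩ => ?_
        rw [← edgeLength_swap, Prod.swap_prod_mk, edgeLength_of_le hyx.le] at hlen
        obtain ⟨z, hz, hgood⟩ := exists_forall_gap_good hX he (by simp only; omega)
        exact ⟨z, by simp [start, hz], fun k l hkl hzk hkz => hgood k l hkl hzk hkz.le⟩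
    _ ≤ ∑ y ∈ start, (2 * η) ^ (X / 2) :=
        (measureReal_exists_le_sum r _ _).trans <| Finset.sum_le_sum fun y hy =>
          measureReal_forall_gap_good_le hr hp hη0 hη1 hη
            (Nat.lt_of_succ_lt (Finset.mem_filter.mp hy).2)
    _ ≤ n * (2 * η) ^ (X / 2) := by
        rw [Finset.sum_const, nsmul_eq_mul]
        gcongr
        exact_mod_cast (Finset.card_le_univ start).trans_eq (Fintype.card_fin n)

lemma measureReal_exists_long_rightward_le (hr : ∀ e, IsRightward e → (r e : ℝ) ≤ p)
    (hp : 0 ≤ p) (hη0 : 0 ≤ η) (hη1 : η ≤ 1) {X : ℕ} (hX : 1 ≤ X)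
    (hη : p + (2 * X : ℕ) * p ^ 2 ≤ η ^ 2) :
    (coinLaw r).real {ω | ∃ e ∈ finalEdges ω, IsRightward e ∧ X < edgeLength e} ≤
      n * (2 * η) ^ (X / 2) := by
  refine le_trans (measureReal_mono_coins r fun ω ⟨e, he, hright, hlen⟩ => ?_)
    ((measureReal_comp r Prod.swap_injective fun ω : Config n =>
      ∃ e ∈ finalEdges ω, IsLeftward e ∧ X < edgeLength e).trans_le
      (measureReal_exists_long_leftward_le (fun e => hr e.swap) hp hη0 hη1 hX hη))
  exact ⟨e.swap, by simpa [finalEdges_comp_swap] using he, hright, by rwa [edgeLength_swap]⟩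

end LongLeftward

/-! ### Filling intervals from one end -/

section Stack

/-- The intervals that can be filled from unit intervals by joining two adjacent filled intervals
whenever their union is open. The interval from `x` to `y` is the pair `(x, y)`. -/
inductive Fill (c : ℕ × ℕ → Bool) : ℕ → ℕ → Prop
  | unit (x : ℕ) : Fill c x (x + 1)
  | join {x z y : ℕ} : c (x, y) = true → Fill c x z → Fill c z y → Fill c x y

lemma Fill.lt {c : ℕ × ℕ → Bool} {x y : ℕ} (h : Fill c x y) : x < y := by
  induction h with
  | unit x => exact x.lt_succ_self
  | join _ _ _ h1 h2 => exact h1.trans h2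

/-- Remove the head of a list as long as the next element satisfies `f`. -/
def pop (f : ℕ → Bool) : List ℕ → List ℕ
  | [] => []
  | [a] => [a]
  | a :: b :: l => if f b then pop f (b :: l) else a :: b :: l

/-- A greedily shortened path of filled intervals from `0` to `y`, stored as the list of its
vertices from right to left, including `0` and excluding `y`. -/
def stack (c : ℕ × ℕ → Bool) : ℕ → List ℕ
  | 0 => []
  | y + 1 => pop (fun x => c (x, y + 1)) (y :: stack c y)

/-- The list `l` is a path of filled intervals from `0` to `y`, read backwards and without `y`. -/
def IsFilledPath (c : ℕ × ℕ → Bool) : List ℕ → ℕ → Prop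
  | [], y => y = 0
  | a :: l, y => Fill c a y ∧ IsFilledPath c l a

/-- The intervals whose coins the stack at `y` reads. -/
def intervalsUpTo (y : ℕ) : Set (ℕ × ℕ) :=
  {p | p.1 < p.2 ∧ p.2 ≤ y}

lemma intervalsUpTo_mono {y z : ℕ} (h : y ≤ z) : intervalsUpTo y ⊆ intervalsUpTo z :=
  fun _ hp => ⟨hp.1, hp.2.trans h⟩

lemma mem_of_mem_pop {f : ℕ → Bool} {l : List ℕ} {x : ℕ} (h : x ∈ pop f l) : x ∈ l := by
  induction l using pop.induct f with
  | case1 => exact h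
  | case2 => exact h
  | case3 a b l hb ih =>
    rw [pop, if_pos hb] at h
    exact List.mem_cons_of_mem _ (ih h)
  | case4 a b l hb => rwa [pop, if_neg hb] at h

lemma pop_congr {f g : ℕ → Bool} {l : List ℕ} (h : ∀ x ∈ l, f x = g x) : pop f l = pop g l := by
  induction l using pop.induct f with
  | case1 => rfl
  | case2 => rfl
  | case3 a b l hb ih =>
    rw [pop, if_pos hb, pop, if_pos (by rw [← h b (by simp), hb]),
      ih fun x hx => h x (List.mem_cons_of_mem _ hx)]
  | case4 a b l hb => rw [pop, if_neg hb, pop, if_neg (by rwa [← h b (by simp)])]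

variable {c : ℕ × ℕ → Bool}

lemma isFilledPath_pop {l : List ℕ} {y : ℕ} (h : IsFilledPath c l y) :
    IsFilledPath c (pop (fun x => c (x, y)) l) y := by
  induction l using pop.induct (fun x => c (x, y)) with
  | case1 => exact h
  | case2 => exact h
  | case3 a b l hb ih =>
    rw [pop, if_pos hb]
    exact ih ⟨.join hb h.2.1 h.1, h.2.2⟩
  | case4 a b l hb => rwa [pop, if_neg hb]

lemma isFilledPath_stack (c : ℕ × ℕ → Bool) (y : ℕ) : IsFilledPath c (stack c y) y := by
  induction y with
  | zero => rfl
  | succ y ih => exact isFilledPath_pop ⟨.unit y, ih⟩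

lemma lt_of_mem_stack {y x : ℕ} (h : x ∈ stack c y) : x < y := by
  induction y with
  | zero => simp [stack] at h
  | succ y ih =>
    rcases List.mem_cons.mp (mem_of_mem_pop h) with rfl | h
    · exact Nat.lt_succ_self _
    · exact (ih h).trans (Nat.lt_succ_self _)

lemma dependsOn_stack (y : ℕ) : DependsOn (fun c => stack c y) (intervalsUpTo y) := by
  induction y with
  | zero => exact fun _ _ _ => rfl
  | succ y ih =>
    intro c d h
    have hy : stack c y = stack d y :=
      ih fun p hp => h p (intervalsUpTo_mono y.le_succ hp)
    simp only [stack, hy]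
    refine pop_congr fun x hx => h (x, y + 1) ⟨?_, le_rfl⟩
    rcases List.mem_cons.mp hx with rfl | hx
    · exact Nat.lt_succ_self _
    · exact (lt_of_mem_stack hx).trans (Nat.lt_succ_self _)

lemma fill_of_length_stack_lt_two {y : ℕ} (hy : 0 < y) (h : (stack c y).length < 2) :
    Fill c 0 y := by
  have hp := isFilledPath_stack c y
  rcases hl : stack c y with _ | ⟨a, _ | ⟨b, l⟩⟩
  · rw [hl] at hp
    exact absurd hp hy.ne'
  · rw [hl] at hp
    obtain ⟨h1, rfl⟩ := hp
    exact h1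
  · simp [hl] at h

/-- The endpoints `k ≤ y` with a stack of length at least two; for all other endpoints `k > 0`
the interval from `0` to `k` is filled. -/
def longStacks (c : ℕ × ℕ → Bool) (y : ℕ) : Finset ℕ :=
  (Finset.range (y + 1)).filter fun k => 2 ≤ (stack c k).length

lemma fill_of_notMem_longStacks {k y : ℕ} (hk : 0 < k) (hky : k ≤ y) (h : k ∉ longStacks c y) :
    Fill c 0 k := by
  refine fill_of_length_stack_lt_two hk (not_le.mp fun h2 => h ?_)
  exact Finset.mem_filter.mpr ⟨Finset.mem_range_succ_iff.mpr hky, h2⟩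

lemma card_longStacks_succ (c : ℕ × ℕ → Bool) (y : ℕ) :
    (longStacks c (y + 1)).card =
      (longStacks c y).card + if 2 ≤ (stack c (y + 1)).length then 1 else 0 := by
  simp only [longStacks]
  rw [Finset.range_add_one, Finset.filter_insert]
  split_ifs
  · rw [Finset.card_insert_of_notMem (by simp)]
  · rfl

lemma dependsOn_longStacks (y : ℕ) :
    DependsOn (fun c => longStacks c y) (intervalsUpTo y) := fun c d h =>
  Finset.filter_congr fun k hk => by
    have hk : stack c k = stack d k := dependsOn_stack k fun p hp =>
      h p (intervalsUpTo_mono (Finset.mem_range_succ_iff.mp hk) hp)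
    rw [hk]

/-- The total weight of the occurrences of `x` in a list, where the weight of an occurrence is
`2 ^ m` if popping stops there with a list of length `m`. -/
def popWeight : List ℕ → ℕ → ℝ
  | [], _ => 0
  | b :: l, x => (if b = x then 2 ^ (l.length + 2) else 0) + popWeight l x

lemma popWeight_nonneg (l : List ℕ) (x : ℕ) : 0 ≤ popWeight l x := by
  induction l with
  | nil => exact le_rfl
  | cons b l ih =>
    unfold popWeight
    split_ifs <;> positivity

lemma sum_popWeight_le (s : Finset ℕ) (l : List ℕ) :
    ∑ x ∈ s, popWeight l x ≤ 4 * 2 ^ l.length := by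
  induction l with
  | nil => simp [popWeight]
  | cons b l ih =>
    have hb : (if b ∈ s then (2 : ℝ) ^ (l.length + 2) else 0) ≤ 2 ^ (l.length + 2) := by
      split_ifs
      · exact le_rfl
      · positivity
    simp only [popWeight, Finset.sum_add_distrib, Finset.sum_ite_eq, List.length_cons]
    calc _ ≤ (2 : ℝ) ^ (l.length + 2) + 4 * 2 ^ l.length := add_le_add hb ih
      _ = 4 * 2 ^ (l.length + 1) := by ring

/-- Either everything is popped, or popping stops in front of some `x` with `f x = false`. -/
lemma pow_mul_two_pow_length_pop_le {θ : ℝ} (hθ : 1 ≤ θ) (f : ℕ → Bool) (s : Finset ℕ) (a : ℕ)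
    {t : List ℕ} (hs : ∀ x ∈ t, x ∈ s) :
    θ ^ (if 2 ≤ (pop f (a :: t)).length then 1 else 0) * 2 ^ (pop f (a :: t)).length ≤
      2 + θ * ∑ x ∈ s, popWeight t x * if f x then 0 else 1 := by
  have hnn (t : List ℕ) (x : ℕ) : 0 ≤ popWeight t x * if f x then 0 else 1 :=
    mul_nonneg (popWeight_nonneg _ _) (by split_ifs <;> norm_num)
  induction t generalizing a with
  | nil => simp [pop, popWeight]
  | cons b l ih =>
    by_cases hb : f b = true
    · rw [pop, if_pos hb]
      refine (ih b fun x hx => hs x (List.mem_cons_of_mem _ hx)).trans ?_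
      gcongr with x _
      exact le_add_of_nonneg_left (by split_ifs <;> positivity)
    · rw [pop, if_neg hb]
      have hle : (2 : ℝ) ^ (l.length + 2) ≤
          ∑ x ∈ s, popWeight (b :: l) x * if f x then 0 else 1 := by
        refine le_trans ?_ (Finset.single_le_sum (fun x _ => hnn (b :: l) x) (hs b (by simp)))
        simp only [popWeight, if_true, if_neg hb, mul_one]
        linarith [popWeight_nonneg l b]
      simp only [List.length_cons, show 2 ≤ l.length + 1 + 1 by omega, if_true, pow_one]
      nlinarith

/-- The quantity whose expectation grows by at most a constant factor in each step. -/
noncomputable def stackWeight (θ : ℝ) (c : ℕ × ℕ → Bool) (y : ℕ) : ℝ :=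
  θ ^ (longStacks c y).card * 2 ^ (stack c y).length

lemma stackWeight_succ_le {θ : ℝ} (hθ : 1 ≤ θ) (c : ℕ × ℕ → Bool) (y : ℕ) :
    stackWeight θ c (y + 1) ≤ 2 * stackWeight θ c y + θ * ∑ x ∈ Finset.range y,
      θ ^ (longStacks c y).card * popWeight (stack c y) x * if c (x, y + 1) then 0 else 1 := by
  have hpop := pow_mul_two_pow_length_pop_le hθ (fun x => c (x, y + 1)) (Finset.range y) y
    (t := stack c y) fun x hx => Finset.mem_range.mpr (lt_of_mem_stack hx)
  have hlen : (1 : ℝ) ≤ 2 ^ (stack c y).length := one_le_pow₀ one_le_two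
  have hθ' : 0 ≤ θ ^ (longStacks c y).card := by positivity
  unfold stackWeight
  rw [card_longStacks_succ, pow_add, mul_assoc]
  simp only [mul_assoc, ← Finset.mul_sum]
  refine (mul_le_mul_of_nonneg_left hpop hθ').trans ?_
  nlinarith

lemma sum_popWeight_le_stackWeight {θ : ℝ} (hθ : 0 ≤ θ) (c : ℕ × ℕ → Bool) (y : ℕ)
    (s : Finset ℕ) :
    ∑ x ∈ s, θ ^ (longStacks c y).card * popWeight (stack c y) x ≤ 4 * stackWeight θ c y := by
  rw [← Finset.mul_sum, stackWeight, mul_left_comm]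
  exact mul_le_mul_of_nonneg_left (sum_popWeight_le _ _) (by positivity)

end Stack

section StackProbability

variable {ι : Type*} [Fintype ι] (r : ι → unitInterval)

lemma integral_mul_coin_false {F : (ι → Bool) → ℝ} {s : Set ι} {i : ι} (hF : DependsOn F s)
    (hi : i ∉ s) :
    ∫ ω, F ω * (if ω i then 0 else 1) ∂coinLaw r = (∫ ω, F ω ∂coinLaw r) * (1 - r i) := by
  have hcoin : ∫ ω, (if ω i then 0 else 1) ∂coinLaw r = 1 - (r i : ℝ) := by
    rw [← measureReal_coin_false, ← integral_indicator_one (Set.toFinite _).measurableSet]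
    congr with ω
    by_cases h : ω i <;> simp [h]
  rw [integral_mul_of_dependsOn r (Set.disjoint_singleton_right.mpr hi) hF
    fun ω ω' h => by simp only [h i rfl], hcoin]

variable {f : ℕ × ℕ → ι} {q θ : ℝ}

lemma integral_popWeight_le {y x : ℕ} (hf : Set.InjOn f (intervalsUpTo (y + 1)))
    (hq : 1 - (r (f (x, y + 1)) : ℝ) ≤ q) (hθ : 0 ≤ θ) (hx : x ≤ y) :
    ∫ ω, θ ^ (longStacks (ω ∘ f) y).card * popWeight (stack (ω ∘ f) y) x *
        (if ω (f (x, y + 1)) then 0 else 1) ∂coinLaw r ≤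
      (∫ ω, θ ^ (longStacks (ω ∘ f) y).card * popWeight (stack (ω ∘ f) y) x ∂coinLaw r) * q := by
  rw [integral_mul_coin_false r (s := f '' intervalsUpTo y)]
  · refine mul_le_mul_of_nonneg_left hq (integral_nonneg fun ω => ?_)
    exact mul_nonneg (pow_nonneg hθ _) (popWeight_nonneg _ _)
  · intro ω ω' h
    have h' : ∀ p ∈ intervalsUpTo y, (ω ∘ f) p = (ω' ∘ f) p :=
      fun p hp => h _ (Set.mem_image_of_mem f hp)
    have hS : stack (ω ∘ f) y = stack (ω' ∘ f) y := dependsOn_stack y h'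
    have hL : longStacks (ω ∘ f) y = longStacks (ω' ∘ f) y := dependsOn_longStacks y h'
    simp only [hS, hL]
  · rintro ⟨p, hp, hpf⟩
    obtain rfl := hf (intervalsUpTo_mono y.le_succ hp) ⟨Nat.lt_succ_of_le hx, le_rfl⟩ hpf
    exact absurd hp.2 (by simp)

lemma integral_stackWeight_succ_le {y : ℕ} (hf : Set.InjOn f (intervalsUpTo (y + 1)))
    (hq : ∀ p ∈ intervalsUpTo (y + 1), 1 - (r (f p) : ℝ) ≤ q) (hθ : 1 ≤ θ) (hθq : θ * q ≤ 1) :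
    ∫ ω, stackWeight θ (ω ∘ f) (y + 1) ∂coinLaw r ≤
      6 * ∫ ω, stackWeight θ (ω ∘ f) y ∂coinLaw r := by
  have hθ0 : 0 ≤ θ := zero_le_one.trans hθ
  let w (ω : ι → Bool) (x : ℕ) : ℝ :=
    θ ^ (longStacks (ω ∘ f) y).card * popWeight (stack (ω ∘ f) y) x
  have hw (ω x) : 0 ≤ w ω x := mul_nonneg (pow_nonneg hθ0 _) (popWeight_nonneg _ _)
  have hwsum : ∑ x ∈ Finset.range y, ∫ ω, w ω x ∂coinLaw r ≤
      4 * ∫ ω, stackWeight θ (ω ∘ f) y ∂coinLaw r := by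
    rw [← integral_finsetSum _ fun _ _ => .of_finite, ← integral_const_mul]
    exact integral_mono .of_finite .of_finite fun ω => sum_popWeight_le_stackWeight hθ0 _ _ _
  calc ∫ ω, stackWeight θ (ω ∘ f) (y + 1) ∂coinLaw r
      ≤ ∫ ω, (2 * stackWeight θ (ω ∘ f) y + θ * ∑ x ∈ Finset.range y,
          w ω x * if ω (f (x, y + 1)) then 0 else 1) ∂coinLaw r :=
        integral_mono .of_finite .of_finite fun ω => stackWeight_succ_le hθ _ _
    _ = 2 * ∫ ω, stackWeight θ (ω ∘ f) y ∂coinLaw r + θ * ∑ x ∈ Finset.range y,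
          ∫ ω, w ω x * (if ω (f (x, y + 1)) then 0 else 1) ∂coinLaw r := by
        rw [integral_add .of_finite .of_finite, integral_const_mul, integral_const_mul,
          integral_finsetSum _ fun _ _ => .of_finite]
    _ ≤ 2 * ∫ ω, stackWeight θ (ω ∘ f) y ∂coinLaw r + θ * ∑ x ∈ Finset.range y,
          (∫ ω, w ω x ∂coinLaw r) * q := by
        gcongr with x hx
        have hxy := Finset.mem_range.mp hx
        exact integral_popWeight_le r hf (hq _ ⟨by simp only; omega, le_rfl⟩) hθ0 hxy.le
    _ = 2 * ∫ ω, stackWeight θ (ω ∘ f) y ∂coinLaw r +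
          (θ * q) * ∑ x ∈ Finset.range y, ∫ ω, w ω x ∂coinLaw r := by
        rw [← Finset.sum_mul]
        ring
    _ ≤ 6 * ∫ ω, stackWeight θ (ω ∘ f) y ∂coinLaw r := by
        have hnn : 0 ≤ ∑ x ∈ Finset.range y, ∫ ω, w ω x ∂coinLaw r :=
          Finset.sum_nonneg fun x _ => integral_nonneg fun ω => hw ω x
        linarith [mul_le_of_le_one_left hnn hθq]

lemma integral_stackWeight_le {y : ℕ} (hf : Set.InjOn f (intervalsUpTo y))
    (hq : ∀ p ∈ intervalsUpTo y, 1 - (r (f p) : ℝ) ≤ q) (hθ : 1 ≤ θ) (hθq : θ * q ≤ 1) :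
    ∫ ω, stackWeight θ (ω ∘ f) y ∂coinLaw r ≤ 6 ^ y := by
  induction y with
  | zero => simp [stackWeight, longStacks, stack, Finset.filter_singleton]
  | succ y ih =>
    have hsub := intervalsUpTo_mono y.le_succ
    have ih := ih (hf.mono hsub) fun p hp => hq p (hsub hp)
    rw [pow_succ']
    exact (integral_stackWeight_succ_le r hf hq hθ hθq).trans (by linarith)

lemma measureReal_le_two_mul_card_longStacks_le {s : ℝ} {y : ℕ}
    (hf : Set.InjOn f (intervalsUpTo y))
    (hq : ∀ p ∈ intervalsUpTo y, 1 - (r (f p) : ℝ) ≤ s ^ 2) (hs0 : 0 < s) (hs1 : s ≤ 1) :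
    (coinLaw r).real {ω | y ≤ 2 * (longStacks (ω ∘ f) y).card} ≤ (6 * s) ^ y := by
  have hθ : 1 ≤ s⁻¹ := (one_le_inv₀ hs0).mpr hs1
  have hweight (ω : ι → Bool) (h : y ≤ 2 * (longStacks (ω ∘ f) y).card) :
      s⁻¹ ^ y ≤ stackWeight (s⁻¹ ^ 2) (ω ∘ f) y := by
    rw [stackWeight, ← pow_mul]
    exact (pow_le_pow_right₀ hθ h).trans
      (le_mul_of_one_le_right (by positivity) (one_le_pow₀ one_le_two))
  have hmarkov := mul_meas_ge_le_integral_of_nonneg (μ := coinLaw r)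
    (f := fun ω => stackWeight (s⁻¹ ^ 2) (ω ∘ f) y)
    (.of_forall fun ω => by simp only [stackWeight, Pi.zero_apply]; positivity) .of_finite (s⁻¹ ^ y)
  have hint := integral_stackWeight_le r hf hq (one_le_pow₀ hθ)
    (by rw [← mul_pow, inv_mul_cancel₀ hs0.ne', one_pow])
  have h := (mul_le_mul_of_nonneg_left (measureReal_mono_coins r hweight)
    (by positivity)).trans (hmarkov.trans hint)
  rwa [inv_pow, inv_mul_le_iff₀ (by positivity), ← mul_pow, mul_comm s] at h

end StackProbability

section Rightward

variable {n : ℕ}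

lemma Fill.mem_finalEdges {ω : Config n} {v : ℕ → Fin n} {x y m : ℕ}
    (h : Fill (ω ∘ Prod.map v v) x y) (hline : ∀ k < m, (v k, v (k + 1)) ∈ lineEdges n)
    (hinj : Set.InjOn v (Set.Iic m)) (hy : y ≤ m) : (v x, v y) ∈ finalEdges ω := by
  induction h with
  | unit x => exact lineEdges_subset_finalEdges ω (hline x hy)
  | join hc h1 h2 ih1 ih2 =>
    have hzm := h2.lt.le.trans hy
    refine mem_finalEdges_of_join (fun h => ?_) hc (ih1 hzm) (ih2 hy)
    exact (h1.lt.trans h2.lt).ne (hinj (h1.lt.le.trans hzm) hy h)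

/-- The vertex `i + k`, capped at the last vertex. -/
def shiftRight (i : Fin n) (k : ℕ) : Fin n := ⟨min (i.val + k) (n - 1), by omega⟩

/-- The vertex `j - k`, capped at the first vertex. -/
def shiftLeft (j : Fin n) (k : ℕ) : Fin n := ⟨j.val - k, by omega⟩

lemma val_shiftRight {i : Fin n} {k : ℕ} (h : i.val + k < n) : (shiftRight i k).val = i.val + k :=
  min_eq_left (by omega)

lemma injOn_shiftRight {i : Fin n} {m : ℕ} (h : i.val + m < n) :
    Set.InjOn (shiftRight i) (Set.Iic m) := by
  intro k hk l hl hkl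
  rw [Set.mem_Iic] at hk hl
  rw [Fin.ext_iff, val_shiftRight (by omega), val_shiftRight (by omega)] at hkl
  omega

lemma injOn_shiftLeft {j : Fin n} {m : ℕ} (h : m ≤ j.val) :
    Set.InjOn (shiftLeft j) (Set.Iic m) := by
  intro k hk l hl hkl
  rw [Set.mem_Iic] at hk hl
  simp only [shiftLeft, Fin.mk.injEq] at hkl
  omega

lemma injOn_prodMap_intervalsUpTo {v : ℕ → Fin n} {m : ℕ} (hv : Set.InjOn v (Set.Iic m)) :
    Set.InjOn (Prod.map v v) (intervalsUpTo m) :=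
  (hv.prodMap hv).mono fun _ hp => Set.mk_mem_prod (hp.1.le.trans hp.2) hp.2

lemma mem_finalEdges_of_fill_right {ω : Config n} {i : Fin n} {k : ℕ} (hk : i.val + k < n)
    (h : Fill (ω ∘ Prod.map (shiftRight i) (shiftRight i)) 0 k) :
    (i, shiftRight i k) ∈ finalEdges ω := by
  have hline (l : ℕ) (hl : l < k) : (shiftRight i l, shiftRight i (l + 1)) ∈ lineEdges n := by
    refine mem_lineEdges.mpr (Or.inl ?_)
    rw [val_shiftRight (by omega), val_shiftRight (by omega), add_assoc]
  have hi : shiftRight i 0 = i := Fin.ext (val_shiftRight i.2)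
  simpa only [hi] using h.mem_finalEdges hline (injOn_shiftRight hk) le_rfl

lemma mem_finalEdges_of_fill_left {ω : Config n} {j : Fin n} {k : ℕ} (hk : k ≤ j.val)
    (h : Fill ((ω ∘ Prod.swap) ∘ Prod.map (shiftLeft j) (shiftLeft j)) 0 k) :
    (shiftLeft j k, j) ∈ finalEdges ω := by
  have hline (l : ℕ) (hl : l < k) : (shiftLeft j l, shiftLeft j (l + 1)) ∈ lineEdges n := by
    refine mem_lineEdges.mpr (Or.inr ?_)
    simp only [shiftLeft]
    omega
  have hmem := h.mem_finalEdges hline (injOn_shiftLeft hk) le_rfl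
  rw [finalEdges_comp_swap] at hmem
  exact hmem

/-- If no vertex strictly between `i` and `j` is both reached from `i` and reaches `j`, then each
of them gives a long stack from one of the two ends. -/
lemma card_longStacks_of_notMem_finalEdges {ω : Config n} {i j : Fin n} {m : ℕ}
    (hij : i.val + (m + 1) = j.val) (hopen : (i, j) ∈ openEdges ω) (hnot : (i, j) ∉ finalEdges ω) :
    m ≤ 2 * (longStacks (ω ∘ Prod.map (shiftRight i) (shiftRight i)) m).card ∨
      m ≤ 2 * (longStacks ((ω ∘ Prod.swap) ∘ Prod.map (shiftLeft j) (shiftLeft j)) m).card := by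
  set S := longStacks (ω ∘ Prod.map (shiftRight i) (shiftRight i)) m
  set T := longStacks ((ω ∘ Prod.swap) ∘ Prod.map (shiftLeft j) (shiftLeft j)) m
  have hcover : Finset.Icc 1 m ⊆ S ∪ T.image fun k => m + 1 - k := by
    intro k hk
    obtain ⟨hk1, hkm⟩ := Finset.mem_Icc.mp hk
    by_contra hcon
    rw [Finset.mem_union, Finset.mem_image, not_or] at hcon
    have hleft := mem_finalEdges_of_fill_right (by omega)
      (fill_of_notMem_longStacks hk1 hkm hcon.1)
    have hright := mem_finalEdges_of_fill_left (by omega)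
      (fill_of_notMem_longStacks (k := m + 1 - k) (y := m) (by omega) (by omega)
        fun h => hcon.2 ⟨_, h, by omega⟩)
    have hmid : shiftLeft j (m + 1 - k) = shiftRight i k := by
      rw [Fin.ext_iff, val_shiftRight (by omega)]
      simp only [shiftLeft]
      omega
    exact hnot (mem_finalEdges_of_join hopen.2.1 hopen.2.2 hleft (hmid ▸ hright))
  have hcard : m ≤ S.card + T.card :=
    calc m = (Finset.Icc 1 m).card := by rw [Nat.card_Icc, Nat.add_sub_cancel]
      _ ≤ _ := (Finset.card_le_card hcover).trans (Finset.card_union_le _ _)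
      _ ≤ _ := Nat.add_le_add_left Finset.card_image_le _
  omega

variable {r : Fin n × Fin n → unitInterval} {s : ℝ}

lemma measureReal_open_rightward_notMem_le (hs0 : 0 < s) (hs1 : s ≤ 1)
    (hr : ∀ e, IsRightward e → 1 - (r e : ℝ) ≤ s ^ 2) {i j : Fin n} {m : ℕ}
    (hij : i.val + (m + 1) = j.val) :
    (coinLaw r).real {ω | (i, j) ∈ openEdges ω ∧ (i, j) ∉ finalEdges ω} ≤ 2 * (6 * s) ^ m := by
  have hright := measureReal_le_two_mul_card_longStacks_le r (y := m)
    (f := Prod.map (shiftRight i) (shiftRight i))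
    (injOn_prodMap_intervalsUpTo (injOn_shiftRight (by omega)))
    (fun p ⟨hp1, hp2⟩ => hr _ <| Fin.lt_def.mpr <| by
      simp only [Prod.map_fst, Prod.map_snd]
      rw [val_shiftRight (by omega), val_shiftRight (by omega)]
      omega) hs0 hs1
  have hleft := measureReal_le_two_mul_card_longStacks_le r (y := m)
    (f := Prod.swap ∘ Prod.map (shiftLeft j) (shiftLeft j))
    (Prod.swap_injective.comp_injOn (injOn_prodMap_intervalsUpTo (injOn_shiftLeft (by omega))))
    (fun p ⟨hp1, hp2⟩ => hr _ <| Fin.lt_def.mpr <| by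
      simp only [Function.comp_apply, Prod.fst_swap, Prod.snd_swap, Prod.map_fst, Prod.map_snd,
        shiftLeft]
      omega) hs0 hs1
  calc _ ≤ (coinLaw r).real ({ω | _} ∪ {ω | _}) :=
        measureReal_mono_coins r fun ω h => card_longStacks_of_notMem_finalEdges hij h.1 h.2
    _ ≤ (6 * s) ^ m + (6 * s) ^ m := (measureReal_union_le _ _).trans (add_le_add hright hleft)
    _ = 2 * (6 * s) ^ m := (two_mul _).symm

lemma measureReal_exists_long_open_rightward_notMem_le (hs0 : 0 < s) (hs1 : 6 * s ≤ 1)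
    (hr : ∀ e, IsRightward e → 1 - (r e : ℝ) ≤ s ^ 2) (X : ℕ) :
    (coinLaw r).real {ω | ∃ e ∈ openEdges ω, IsRightward e ∧ X < edgeLength e ∧
      e ∉ finalEdges ω} ≤ n ^ 2 * (2 * (6 * s) ^ X) := by
  classical
  let T : Finset (Fin n × Fin n) := {e | IsRightward e ∧ X < edgeLength e}
  have hone : ∀ e ∈ T,
      (coinLaw r).real {ω | e ∈ openEdges ω ∧ e ∉ finalEdges ω} ≤ 2 * (6 * s) ^ X := by
    rintro ⟨i, j⟩ he
    obtain ⟨hij : i < j, hX⟩ := (Finset.mem_filter.mp he).2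
    rw [edgeLength_of_le hij.le] at hX
    refine (measureReal_open_rightward_notMem_le (m := j.val - i.val - 1) hs0 (by linarith) hr
      (by omega)).trans ?_
    gcongr 2 * ?_
    exact pow_le_pow_of_le_one (by linarith) hs1 (by omega)
  calc _ ≤ (coinLaw r).real {ω | ∃ e ∈ T, e ∈ openEdges ω ∧ e ∉ finalEdges ω} :=
        measureReal_mono_coins r fun ω ⟨e, ho, hr, hX, hnot⟩ =>
          ⟨e, Finset.mem_filter.mpr ⟨Finset.mem_univ e, hr, hX⟩, ho, hnot⟩
    _ ≤ ∑ e ∈ T, (coinLaw r).real {ω | e ∈ openEdges ω ∧ e ∉ finalEdges ω} :=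
        measureReal_exists_le_sum r T _
    _ ≤ T.card • (2 * (6 * s) ^ X) := Finset.sum_le_card_nsmul _ _ _ hone
    _ ≤ n ^ 2 * (2 * (6 * s) ^ X) := by
        rw [nsmul_eq_mul]
        gcongr
        exact_mod_cast T.card_le_univ.trans_eq (by simp [sq])

end Rightward

/-! ### Cuts in random neighbourhoods -/

section CutSum

lemma exp_neg_le_one_sub_half {u : ℝ} (h0 : 0 ≤ u) (h1 : u ≤ 1) : Real.exp (-u) ≤ 1 - u / 2 := by
  rw [Real.exp_neg, inv_le_comm₀ (Real.exp_pos u) (by linarith)]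
  refine le_trans ?_ (Real.add_one_le_exp u)
  rw [inv_le_comm₀ (by linarith) (by linarith), ← one_div, div_le_iff₀ (by linarith)]
  nlinarith

lemma sum_pow_succ_le {z : ℝ} (h0 : 0 ≤ z) (h1 : z ≤ 1 / 2) (m : ℕ) :
    ∑ i ∈ Finset.range m, z ^ (i + 1) ≤ 2 * z := by
  calc ∑ i ∈ Finset.range m, z ^ (i + 1) ≤ ∑ i ∈ Finset.range m, (1 / 2 : ℝ) ^ i * z := by
        simp only [pow_succ]
        gcongr
    _ ≤ 2 * z := by
        rw [← Finset.sum_mul]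
        gcongr
        exact sum_geometric_two_le m

variable {p : ℝ}

lemma mul_exp_neg_pow_le (hp : 0 ≤ p) {m a b N : ℕ} (hN : N ≤ m ^ a) (hb : m ≤ 2 * b) :
    N * Real.exp (-p) ^ (a * b) ≤ (m * Real.exp (-(p * m / 2))) ^ a := by
  have hexp : Real.exp (-p) ^ b ≤ Real.exp (-(p * m / 2)) := by
    have hb : (m : ℝ) ≤ 2 * b := by exact_mod_cast hb
    rw [← Real.exp_nat_mul, Real.exp_le_exp]
    nlinarith
  rw [mul_comm a b, pow_mul, mul_pow]
  gcongr
  exact_mod_cast hN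

lemma choose_mul_exp_neg_pow_le (hp : 0 ≤ p) {m k : ℕ} (hkm : k ≤ m) :
    (m.choose k : ℝ) * Real.exp (-p) ^ (k * (m + 1 - k)) ≤
      (m * Real.exp (-(p * m / 2))) ^ k + (m * Real.exp (-(p * m / 2))) ^ (m + 1 - k) := by
  rcases le_total (2 * k) (m + 1) with h | h
  · exact (mul_exp_neg_pow_le hp (Nat.choose_le_pow m k) (by omega)).trans
      (le_add_of_nonneg_right (by positivity))
  · have hchoose : m.choose k ≤ m ^ (m + 1 - k) := by
      rw [← Nat.choose_symm hkm]
      exact (Nat.choose_le_pow m _).trans (Nat.pow_le_pow_right (by omega) (by omega))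
    rw [mul_comm k]
    exact (mul_exp_neg_pow_le hp hchoose (by omega)).trans
      (le_add_of_nonneg_left (by positivity))

lemma sum_choose_mul_exp_neg_pow_le (hp : 0 ≤ p) {m : ℕ}
    (hz : m * Real.exp (-(p * m / 2)) ≤ 1 / 2) :
    ∑ k ∈ Finset.range (m + 1),
      (m.choose k : ℝ) * (if k = 0 then 0 else Real.exp (-p) ^ (k * (m + 1 - k))) ≤
      4 * (m * Real.exp (-(p * m / 2))) := by
  set z := m * Real.exp (-(p * m / 2))
  have hterm : ∀ i ∈ Finset.range m, (m.choose (i + 1) : ℝ) *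
      Real.exp (-p) ^ ((i + 1) * (m + 1 - (i + 1))) ≤ z ^ (i + 1) + z ^ (m - 1 - i + 1) := by
    intro i hi
    have hi := Finset.mem_range.mp hi
    rw [show m - 1 - i + 1 = m + 1 - (i + 1) by omega]
    exact choose_mul_exp_neg_pow_le hp hi
  rw [Finset.sum_range_succ']
  simp only [Nat.add_eq_zero_iff, one_ne_zero, and_false, if_false, if_true, mul_zero, add_zero]
  refine (Finset.sum_le_sum hterm).trans ?_
  rw [Finset.sum_add_distrib, Finset.sum_range_reflect (fun i => z ^ (i + 1))]
  linarith [sum_pow_succ_le (show 0 ≤ z by positivity) hz m]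

end CutSum

section OpenInto

variable {V : Type*}

/-- The in-neighbours of `w` in `R`. -/
def openInto (ω : V × V → Bool) (R : Finset V) (w : V) : Finset V :=
  R.filter fun x => ω (x, w) = true

lemma mem_openInto {ω : V × V → Bool} {R : Finset V} {w x : V} :
    x ∈ openInto ω R w ↔ x ∈ R ∧ ω (x, w) = true :=
  Finset.mem_filter

lemma openInto_subset (ω : V × V → Bool) (R : Finset V) (w : V) : openInto ω R w ⊆ R :=
  Finset.filter_subset _ _

lemma dependsOn_openInto (R : Finset V) (w : V) :
    DependsOn (fun ω => openInto ω R w) ((R : Set V) ×ˢ {w}) := fun ω ω' h =>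
  Finset.filter_congr fun x hx => by rw [h (x, w) ⟨hx, rfl⟩]

lemma openInto_eq_iff [DecidableEq V] {ω : V × V → Bool} {R N : Finset V} {w : V} (hN : N ⊆ R) :
    openInto ω R w = N ↔ ∀ x ∈ R, ω (x, w) = decide (x ∈ N) := by
  refine ⟨fun h x hx => ?_, fun h => Finset.ext fun x => ?_⟩
  · simp [← h, mem_openInto, hx]
  · rw [mem_openInto]
    exact ⟨fun ⟨hx, hxw⟩ => by simpa [hxw] using h x hx,
      fun hx => ⟨hN hx, by simp [h x (hN hx), hx]⟩⟩

variable [Fintype V] {r : V × V → unitInterval} {p : ℝ}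

variable (r) in
lemma measureReal_openInto_eq [DecidableEq V] {R N : Finset V} (hN : N ⊆ R) (w : V) :
    (coinLaw r).real {ω | openInto ω R w = N} =
      (∏ x ∈ N, (r (x, w) : ℝ)) * ∏ x ∈ R \ N, (1 - (r (x, w) : ℝ)) := by
  simp only [openInto_eq_iff hN]
  rw [measureReal_forall_of_dependsOn r R (s := fun x => {(x, w)})
    (fun x _ y _ hxy => by simpa using hxy) fun x _ => dependsOn_coin _ _,
    ← Finset.prod_sdiff hN, mul_comm]
  congr 1
  · exact Finset.prod_congr rfl fun x hx => by simp only [hx, decide_true, measureReal_coin_true]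
  · refine Finset.prod_congr rfl fun x hx => ?_
    simp only [(Finset.mem_sdiff.mp hx).2, decide_false, measureReal_coin_false]

lemma sum_measureReal_openInto_eq_mul_pow_le (hp0 : 0 ≤ p) (hp1 : p ≤ 1) (hr : ∀ e, p ≤ r e)
    (R : Finset V) (w : V) :
    ∑ N ∈ R.powerset, (coinLaw r).real {ω | openInto ω R w = N} * Real.exp (-(p / 2)) ^ N.card ≤
      Real.exp (-(p ^ 2 / 4)) ^ R.card := by
  classical
  have hexp := exp_neg_le_one_sub_half (u := p / 2) (by linarith) (by linarith)
  have hfactor (x : V) : r (x, w) * Real.exp (-(p / 2)) + (1 - (r (x, w) : ℝ)) ≤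
      Real.exp (-(p ^ 2 / 4)) := by
    nlinarith [hr (x, w), Real.add_one_le_exp (-(p ^ 2 / 4))]
  calc _ = ∑ N ∈ R.powerset, (∏ x ∈ N, r (x, w) * Real.exp (-(p / 2))) *
          ∏ x ∈ R \ N, (1 - (r (x, w) : ℝ)) := by
        refine Finset.sum_congr rfl fun N hN => ?_
        rw [measureReal_openInto_eq r (Finset.mem_powerset.mp hN), Finset.prod_mul_distrib,
          Finset.prod_const, mul_right_comm]
    _ = ∏ x ∈ R, (r (x, w) * Real.exp (-(p / 2)) + (1 - (r (x, w) : ℝ))) :=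
        (Finset.prod_add _ _ _).symm
    _ ≤ ∏ _x ∈ R, Real.exp (-(p ^ 2 / 4)) :=
        Finset.prod_le_prod (fun x _ => add_nonneg (mul_nonneg (r _).2.1 (Real.exp_pos _).le)
          (sub_nonneg.mpr (r _).2.2)) fun x _ => hfactor x
    _ = Real.exp (-(p ^ 2 / 4)) ^ R.card := Finset.prod_const _

end OpenInto

section Cut

variable {V : Type*} [DecidableEq V]

/-- A cut separating the vertices of `N` from `b` in the directed graph of the coins: a nonempty
set of vertices of `N` without edges to the other vertices of `N` and to `b`. -/
def HasCut (ω : V × V → Bool) (N : Finset V) (b : V) : Prop :=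
  ∃ S ⊆ N, S.Nonempty ∧ ∀ x ∈ S, ∀ y ∈ insert b N \ S, ω (x, y) = false

lemma forall_mem_of_not_hasCut {ω : V × V → Bool} {N : Finset V} {b : V} {P : V → Prop}
    (h : ¬ HasCut ω N b) (hb : P b)
    (hstep : ∀ x ∈ N, ∀ y ∈ insert b N, ω (x, y) = true → P y → P x) : ∀ x ∈ N, P x := by
  classical
  by_contra! ⟨x, hx, hPx⟩
  refine h ⟨N.filter fun x => ¬ P x, Finset.filter_subset _ _,
    ⟨x, Finset.mem_filter.mpr ⟨hx, hPx⟩⟩, fun u hu y hy => ?_⟩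
  obtain ⟨huN, hPu⟩ := Finset.mem_filter.mp hu
  obtain ⟨hy, hyS⟩ := Finset.mem_sdiff.mp hy
  have hPy : P y := by
    rcases Finset.mem_insert.mp hy with rfl | hyN
    · exact hb
    · by_contra hPy
      exact hyS (Finset.mem_filter.mpr ⟨hyN, hPy⟩)
  by_contra hne
  exact hPu (hstep u huN y hy (Bool.not_eq_false _ ▸ hne) hPy)

lemma dependsOn_hasCut (N : Finset V) (b : V) :
    DependsOn (fun ω => HasCut ω N b) ((N : Set V) ×ˢ insert b (N : Set V)) := fun ω ω' h => by
  refine propext (exists_congr fun S => and_congr_right fun hS => and_congr_right fun _ =>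
    forall₂_congr fun x hx => forall₂_congr fun y hy => ?_)
  rw [h (x, y) ⟨hS hx, Finset.mem_insert.mp (Finset.mem_sdiff.mp hy).1⟩]

lemma dependsOn_hasCut_openInto (R : Finset V) (b w : V) :
    DependsOn (fun ω => HasCut ω (openInto ω R w) b)
      ((R : Set V) ×ˢ insert w (insert b (R : Set V))) := fun ω ω' h => by
  have hopen : openInto ω R w = openInto ω' R w :=
    dependsOn_openInto R w fun e he => h e ⟨he.1, Or.inl he.2⟩
  have hcut : HasCut ω (openInto ω R w) b = HasCut ω' (openInto ω R w) b :=
    dependsOn_hasCut (openInto ω R w) b fun e he => h e ⟨openInto_subset ω R w he.1,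
      Or.inr (he.2.imp_right fun he => openInto_subset ω R w he)⟩
  exact hcut.trans (by simp only [hopen])

variable [Fintype V] {r : V × V → unitInterval} {p : ℝ}

lemma measureReal_forall_sdiff_false_le (hr : ∀ e, p ≤ r e) {S N : Finset V} {b : V}
    (hS : S ⊆ N) (hb : b ∉ N) :
    (coinLaw r).real {ω | ∀ x ∈ S, ∀ y ∈ insert b N \ S, ω (x, y) = false} ≤
      Real.exp (-p) ^ (S.card * (N.card + 1 - S.card)) := by
  have hcard : (S ×ˢ (insert b N \ S)).card = S.card * (N.card + 1 - S.card) := by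
    rw [Finset.card_product, Finset.card_sdiff_of_subset (hS.trans (Finset.subset_insert b N)),
      Finset.card_insert_of_notMem hb]
  rw [← hcard, ← Finset.prod_const]
  calc _ = (coinLaw r).real {ω | ∀ e ∈ S ×ˢ (insert b N \ S), ω e = false} := by
        simp only [Finset.mem_product, Prod.forall, and_imp]
        congr with ω
        exact forall_congr' fun x => ⟨fun h y hx hy => h hx y hy, fun h hx y hy => h y hx hy⟩
    _ = ∏ e ∈ S ×ˢ (insert b N \ S), (1 - (r e : ℝ)) := by
        rw [measureReal_forall_coin_eq]
        simp only [measureReal_coin_false]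
    _ ≤ ∏ _e ∈ S ×ˢ (insert b N \ S), Real.exp (-p) :=
        Finset.prod_le_prod (fun e _ => sub_nonneg.mpr (r e).2.2)
          fun e _ => by linarith [hr e, Real.add_one_le_exp (-p)]

lemma measureReal_hasCut_le (hp : 0 ≤ p) (hr : ∀ e, p ≤ r e) {N : Finset V} {b : V}
    (hb : b ∉ N) :
    (coinLaw r).real {ω | HasCut ω N b} ≤ 4 * (N.card * Real.exp (-(p * N.card / 2))) := by
  rcases le_total (N.card * Real.exp (-(p * N.card / 2))) (1 / 2) with hz | hz
  swap
  · exact measureReal_le_one.trans (by linarith)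
  have hS : ∀ S ∈ N.powerset, (coinLaw r).real {ω | S.Nonempty ∧
      ∀ x ∈ S, ∀ y ∈ insert b N \ S, ω (x, y) = false} ≤
      if S.card = 0 then 0 else Real.exp (-p) ^ (S.card * (N.card + 1 - S.card)) := by
    intro S hS
    split_ifs with h0
    · simp [Finset.card_eq_zero.mp h0]
    · exact (measureReal_mono_coins r fun _ h => h.2).trans
        (measureReal_forall_sdiff_false_le hr (Finset.mem_powerset.mp hS) hb)
  calc (coinLaw r).real {ω | HasCut ω N b}
      ≤ (coinLaw r).real {ω | ∃ S ∈ N.powerset, S.Nonempty ∧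
          ∀ x ∈ S, ∀ y ∈ insert b N \ S, ω (x, y) = false} :=
        measureReal_mono_coins r fun ω ⟨S, hS, h⟩ => ⟨S, Finset.mem_powerset.mpr hS, h⟩
    _ ≤ ∑ S ∈ N.powerset,
          if S.card = 0 then 0 else Real.exp (-p) ^ (S.card * (N.card + 1 - S.card)) :=
        (measureReal_exists_le_sum r _ _).trans (Finset.sum_le_sum hS)
    _ ≤ _ := by
        rw [Finset.sum_powerset_apply_card (fun k => if k = 0 then (0 : ℝ) else
          Real.exp (-p) ^ (k * (N.card + 1 - k)))]
        simp only [nsmul_eq_mul]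
        exact sum_choose_mul_exp_neg_pow_le hp hz

/-- The edges into `w` decide which of the other edges matter, and are independent of them. -/
lemma measureReal_hasCut_openInto_le (hp0 : 0 ≤ p) (hp1 : p ≤ 1) (hr : ∀ e, p ≤ r e)
    {R : Finset V} {b w : V} (hb : b ∉ R) (hw : w ∉ R) (hbw : b ≠ w) :
    (coinLaw r).real {ω | HasCut ω (openInto ω R w) b} ≤
      4 * R.card * Real.exp (-(p ^ 2 / 4)) ^ R.card := by
  have hN : ∀ N ∈ R.powerset, (coinLaw r).real {ω | openInto ω R w = N ∧ HasCut ω N b} ≤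
      4 * R.card * ((coinLaw r).real {ω | openInto ω R w = N} *
        Real.exp (-(p / 2)) ^ N.card) := by
    intro N hN
    have hNR := Finset.mem_powerset.mp hN
    have hcut := measureReal_hasCut_le hp0 hr (b := b) fun h => hb (hNR h)
    have hcard : (N.card : ℝ) ≤ R.card := by exact_mod_cast Finset.card_le_card hNR
    have hexp : Real.exp (-(p * N.card / 2)) = Real.exp (-(p / 2)) ^ N.card := by
      rw [← Real.exp_nat_mul]
      ring_nf
    have hdisj : Disjoint ((R : Set V) ×ˢ {w}) ((N : Set V) ×ˢ insert b (N : Set V)) :=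
      Set.disjoint_prod.mpr <| Or.inr <| Set.disjoint_singleton_left.mpr <|
        not_or.mpr ⟨hbw.symm, fun h => hw (hNR h)⟩
    rw [measureReal_and_of_dependsOn r hdisj
      (fun ω ω' h => congrArg (· = N) (dependsOn_openInto R w h)) (dependsOn_hasCut N b),
      mul_left_comm]
    refine mul_le_mul_of_nonneg_left (hcut.trans ?_) measureReal_nonneg
    rw [hexp, mul_assoc]
    gcongr
  calc (coinLaw r).real {ω | HasCut ω (openInto ω R w) b}
      ≤ (coinLaw r).real {ω | ∃ N ∈ R.powerset, openInto ω R w = N ∧ HasCut ω N b} :=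
        measureReal_mono_coins r fun ω h =>
          ⟨_, Finset.mem_powerset.mpr (openInto_subset ω R w), rfl, h⟩
    _ ≤ ∑ N ∈ R.powerset, 4 * R.card * ((coinLaw r).real {ω | openInto ω R w = N} *
          Real.exp (-(p / 2)) ^ N.card) :=
        (measureReal_exists_le_sum r _ _).trans (Finset.sum_le_sum hN)
    _ ≤ 4 * R.card * Real.exp (-(p ^ 2 / 4)) ^ R.card := by
        rw [← Finset.mul_sum]
        gcongr
        exact sum_measureReal_openInto_eq_mul_pow_le hp0 hp1 hr R w

end Cut

/-! ### Growing a saturated interval -/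

section Growth

variable {n : ℕ} {ω : Config n} {R : Finset (Fin n)} {u w : Fin n}

/-- All open edges inside `R` are eventually occupied. -/
def Saturated (ω : Config n) (R : Finset (Fin n)) : Prop :=
  ∀ x ∈ R, ∀ y ∈ R, (x, y) ∈ lineEdges n ∪ openEdges ω → (x, y) ∈ finalEdges ω

/-- A cut in the in-neighbourhood or, after reversing all edges, in the out-neighbourhood of `w`
in `R`, which may prevent the saturation of `R` from spreading from `u ∈ R` to its neighbour `w`. -/
def StepFail (ω : Config n) (R : Finset (Fin n)) (u w : Fin n) : Prop :=
  HasCut ω (openInto ω (R.erase u) w) u ∨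
    HasCut (ω ∘ Prod.swap) (openInto (ω ∘ Prod.swap) (R.erase u) w) u

lemma Saturated.comp_swap (h : Saturated ω R) : Saturated (ω ∘ Prod.swap) R := by
  intro x hx y hy hxy
  rw [openEdges_comp_swap, ← preimage_swap_lineEdges, ← Set.preimage_union] at hxy
  rw [finalEdges_comp_swap]
  exact h y hy x hx hxy

lemma Saturated.mem_finalEdges_of_not_hasCut (h : Saturated ω R) (hu : u ∈ R) (hw : w ∉ R)
    (huw : (u, w) ∈ lineEdges n) (hcut : ¬ HasCut ω (openInto ω (R.erase u) w) u) {x : Fin n}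
    (hx : x ∈ R) (hxw : ω (x, w) = true) : (x, w) ∈ finalEdges ω := by
  rcases eq_or_ne x u with rfl | hxu
  · exact lineEdges_subset_finalEdges ω huw
  refine forall_mem_of_not_hasCut (P := fun x => (x, w) ∈ finalEdges ω) hcut
    (lineEdges_subset_finalEdges ω huw) (fun x hx y hy hxy hyw => ?_) x
    (mem_openInto.mpr ⟨Finset.mem_erase.mpr ⟨hxu, hx⟩, hxw⟩)
  obtain ⟨hx, hxw⟩ := mem_openInto.mp hx
  replace hx := Finset.mem_of_mem_erase hx
  replace hy : y ∈ R := by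
    rcases Finset.mem_insert.mp hy with rfl | hy
    · exact hu
    · exact Finset.mem_of_mem_erase (mem_openInto.mp hy).1
  rcases eq_or_ne x y with rfl | hne
  · exact hyw
  · exact mem_finalEdges_of_join (ne_of_mem_of_not_mem hx hw) hxw
      (h x hx y hy (mem_lineEdges_union_openEdges hne hxy)) hyw

lemma Saturated.insert_vertex (h : Saturated ω R) (hu : u ∈ R) (hw : w ∉ R)
    (huw : (u, w) ∈ lineEdges n) (hstep : ¬ StepFail ω R u w) : Saturated ω (insert w R) := by
  obtain ⟨hin, hout⟩ := not_or.mp hstep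
  rintro x hx y hy (hline | hopen)
  · exact lineEdges_subset_finalEdges ω hline
  rcases Finset.mem_insert.mp hx with rfl | hxR <;>
    rcases Finset.mem_insert.mp hy with rfl | hyR
  · exact absurd rfl hopen.2.1
  · have := h.comp_swap.mem_finalEdges_of_not_hasCut hu hw huw hout hyR hopen.2.2
    rwa [finalEdges_comp_swap] at this
  · exact h.mem_finalEdges_of_not_hasCut hu hw huw hin hxR hopen.2.2
  · exact h x hxR y hyR (Or.inr hopen)

lemma dependsOn_stepFail (hu : u ∈ R) (w : Fin n) :
    DependsOn (fun ω => StepFail ω R u w)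
      ((insert w R : Finset (Fin n)) ×ˢ (insert w R : Finset (Fin n)) : Set (Fin n × Fin n)) := by
  intro ω ω' h
  have herase {x : Fin n} (hx : x ∈ ((R.erase u : Finset (Fin n)) : Set (Fin n))) :
      x ∈ insert w R := Finset.mem_insert_of_mem (Finset.mem_of_mem_erase hx)
  have hinsert {x : Fin n} (hx : x ∈ insert w (insert u ((R.erase u : Finset _) : Set (Fin n)))) :
      x ∈ insert w R := by
    rcases hx with rfl | rfl | hx
    exacts [Finset.mem_insert_self _ _, Finset.mem_insert_of_mem hu, herase hx]
  exact congrArg₂ _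
    (dependsOn_hasCut_openInto (R.erase u) u w fun e he => h e ⟨herase he.1, hinsert he.2⟩)
    (dependsOn_hasCut_openInto (R.erase u) u w fun e he => h e.swap ⟨hinsert he.2, herase he.1⟩)

/-- Bounds the probability that a growth step of an interval of length `ℓ + 1` fails. -/
noncomputable def failBound (p : ℝ) (ℓ : ℕ) : ℝ := 8 * ℓ * Real.exp (-(p ^ 2 / 4)) ^ ℓ

lemma failBound_nonneg (p : ℝ) (ℓ : ℕ) : 0 ≤ failBound p ℓ := by
  rw [failBound]
  positivity

lemma failBound_le (p : ℝ) {b ℓ m : ℕ} (hb : b ≤ ℓ) (hm : ℓ ≤ m) :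
    failBound p ℓ ≤ 8 * m * Real.exp (-(p ^ 2 / 4)) ^ b := by
  have hexp : Real.exp (-(p ^ 2 / 4)) ≤ 1 := Real.exp_le_one_iff.mpr (by linarith [sq_nonneg p])
  rw [failBound]
  gcongr ?_ * ?_
  · gcongr
  · exact pow_le_pow_of_le_one (Real.exp_pos _).le hexp hb

variable {r : Fin n × Fin n → unitInterval} {p : ℝ}

lemma measureReal_stepFail_le (hp0 : 0 ≤ p) (hp1 : p ≤ 1) (hr : ∀ e, p ≤ r e) (hu : u ∈ R)
    (hw : w ∉ R) : (coinLaw r).real {ω | StepFail ω R u w} ≤ failBound p (R.card - 1) := by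
  have hcut {r : Fin n × Fin n → unitInterval} (hr : ∀ e, p ≤ r e) :=
    measureReal_hasCut_openInto_le hp0 hp1 hr (Finset.notMem_erase u R)
      (fun h => hw (Finset.mem_of_mem_erase h)) (ne_of_mem_of_not_mem hu hw)
  rw [Finset.card_erase_of_mem hu] at hcut
  calc (coinLaw r).real {ω | StepFail ω R u w}
      ≤ 4 * (R.card - 1 : ℕ) * Real.exp (-(p ^ 2 / 4)) ^ (R.card - 1) +
          4 * (R.card - 1 : ℕ) * Real.exp (-(p ^ 2 / 4)) ^ (R.card - 1) :=
        (measureReal_union_le _ _).trans <| add_le_add (hcut hr) <|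
          (measureReal_comp r Prod.swap_injective fun ω =>
            HasCut ω (openInto ω (R.erase u) w) u).trans_le (hcut fun e => hr e.swap)
    _ = failBound p (R.card - 1) := by
        rw [failBound]
        ring

lemma measureReal_exists_stepFail_le (hp0 : 0 ≤ p) (hp1 : p ≤ 1) (hr : ∀ e, p ≤ r e) {i j : ℕ}
    (hi : ∀ u : Fin n, u.val = i → u ∈ R) (hj : ∀ w : Fin n, w.val = j → w ∉ R) :
    (coinLaw r).real {ω | ∃ u w : Fin n, u.val = i ∧ w.val = j ∧ StepFail ω R u w} ≤
      failBound p (R.card - 1) := by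
  by_cases h : i < n ∧ j < n
  · refine (measureReal_mono_coins r ?_).trans
      (measureReal_stepFail_le hp0 hp1 hr (hi ⟨i, h.1⟩ rfl) (hj ⟨j, h.2⟩ rfl))
    rintro ω ⟨u, w, rfl, rfl, hω⟩
    exact hω
  · have hempty : {ω : Config n | ∃ u w : Fin n, u.val = i ∧ w.val = j ∧ StepFail ω R u w} = ∅ :=
      Set.eq_empty_of_forall_notMem fun ω ⟨u, w, hu, hw, _⟩ => h ⟨hu ▸ u.2, hw ▸ w.2⟩
    rw [hempty, measureReal_empty]
    exact failBound_nonneg p _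

end Growth

section Segments

variable {n : ℕ} {ω : Config n} {a b : ℕ}

/-- The vertices `x` with `a ≤ x < b`. -/
def seg (n a b : ℕ) : Finset (Fin n) := {x | a ≤ x.val ∧ x.val < b}

lemma mem_seg {x : Fin n} : x ∈ seg n a b ↔ a ≤ x.val ∧ x.val < b := by simp [seg]

lemma card_seg_le (n a b : ℕ) : (seg n a b).card ≤ b - a :=
  card_le_of_val_mem_Ico fun _ hx => Finset.mem_Ico.mpr (mem_seg.mp hx)

lemma card_seg (hb : b ≤ n) : (seg n a b).card = b - a := by
  rw [← Nat.card_Ico a b, ← Finset.card_map Fin.valEmbedding]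
  congr 1
  ext k
  simp only [Finset.mem_map, mem_seg, Fin.valEmbedding_apply, Finset.mem_Ico]
  exact ⟨fun ⟨_, hx, hxk⟩ => hxk ▸ hx, fun hk => ⟨⟨k, hk.2.trans_le hb⟩, hk, rfl⟩⟩

/-- The interval `[a, b)` may fail to grow to the right. -/
def RightFail (ω : Config n) (a b : ℕ) : Prop :=
  ∃ u w : Fin n, u.val = b - 1 ∧ w.val = b ∧ StepFail ω (seg n a b) u w

/-- The interval `[a + 1, n)` may fail to grow to the left. -/
def LeftFail (ω : Config n) (a : ℕ) : Prop :=
  ∃ u w : Fin n, u.val = a + 1 ∧ w.val = a ∧ StepFail ω (seg n (a + 1) n) u w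

lemma Saturated.grow_right {c : ℕ} (h : Saturated ω (seg n a b)) (hab : a < b) (hbc : b ≤ c)
    (hc : c ≤ n) (hstep : ∀ d, b ≤ d → d < c → ¬ RightFail ω a d) : Saturated ω (seg n a c) := by
  induction c, hbc using Nat.le_induction with
  | base => exact h
  | succ c hbc ih =>
    let u : Fin n := ⟨c - 1, by omega⟩
    let w : Fin n := ⟨c, hc⟩
    have hinsert : seg n a (c + 1) = insert w (seg n a c) := by
      ext x
      simp only [Finset.mem_insert, mem_seg, Fin.ext_iff, w]
      omega
    rw [hinsert]
    refine (ih (by omega) fun d hd hdc => hstep d hd (by omega)).insert_vertex (u := u) ?_ ?_ ?_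
      fun hs => hstep c hbc c.lt_succ_self ⟨u, w, rfl, rfl, hs⟩
    all_goals
      simp only [mem_seg, mem_lineEdges, u, w]
      omega

lemma Saturated.grow_left (h : Saturated ω (seg n a n)) (ha : a < n)
    (hstep : ∀ d < a, ¬ LeftFail ω d) : Saturated ω (seg n 0 n) := by
  induction a with
  | zero => exact h
  | succ a ih =>
    let u : Fin n := ⟨a + 1, ha⟩
    let w : Fin n := ⟨a, by omega⟩
    have hinsert : seg n a n = insert w (seg n (a + 1) n) := by
      ext x
      simp only [Finset.mem_insert, mem_seg, Fin.ext_iff, w]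
      omega
    refine ih ?_ w.2 fun d hd => hstep d (by omega)
    rw [hinsert]
    refine h.insert_vertex (u := u) ?_ ?_ ?_ fun hs =>
      hstep a a.lt_succ_self ⟨u, w, rfl, rfl, hs⟩
    · exact mem_seg.mpr ⟨le_rfl, ha⟩
    · exact fun hw => (mem_seg.mp hw).1.not_gt a.lt_succ_self
    · exact mem_lineEdges.mpr (Or.inr rfl)

lemma finalEdges_eq_of_saturated (h : Saturated ω (seg n 0 n)) :
    finalEdges ω = lineEdges n ∪ openEdges ω :=
  (finalEdges_subset ω).antisymm fun e he => h e.1 (mem_seg.mpr ⟨Nat.zero_le _, e.1.2⟩) e.2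
    (mem_seg.mpr ⟨Nat.zero_le _, e.2.2⟩) he

variable {r : Fin n × Fin n → unitInterval} {p : ℝ}

lemma measureReal_rightFail_le (hp0 : 0 ≤ p) (hp1 : p ≤ 1) (hr : ∀ e, p ≤ r e) (hab : a < b)
    (hb : b ≤ n) : (coinLaw r).real {ω | RightFail ω a b} ≤ failBound p (b - a - 1) := by
  rw [← card_seg hb]
  exact measureReal_exists_stepFail_le hp0 hp1 hr
    (fun u (hu : u.val = b - 1) => mem_seg.mpr (by omega))
    fun w hw hmem => (mem_seg.mp hmem).2.ne hw

lemma measureReal_leftFail_le (hp0 : 0 ≤ p) (hp1 : p ≤ 1) (hr : ∀ e, p ≤ r e) (a : ℕ) :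
    (coinLaw r).real {ω | LeftFail ω a} ≤ failBound p (n - (a + 1) - 1) := by
  rw [← card_seg (a := a + 1) le_rfl]
  exact measureReal_exists_stepFail_le hp0 hp1 hr
    (fun u (hu : u.val = a + 1) => mem_seg.mpr (by omega)) fun w (hw : w.val = a) hmem => by
      have := mem_seg.mp hmem
      omega

lemma measureReal_exists_rightFail_le (hp0 : 0 ≤ p) (hp1 : p ≤ 1) (hr : ∀ e, p ≤ r e) {B : ℕ}
    (hB : 1 ≤ B) :
    (coinLaw r).real {ω | ∃ a b, a + B ≤ b ∧ b < n ∧ RightFail ω a b} ≤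
      n ^ 2 * (8 * n * Real.exp (-(p ^ 2 / 4)) ^ (B - 1)) := by
  let T := (Finset.range n ×ˢ Finset.range n).filter fun e => e.1 + B ≤ e.2
  have hT {e : ℕ × ℕ} (he : e ∈ T) : e.1 + B ≤ e.2 ∧ e.2 < n := by
    simp only [T, Finset.mem_filter, Finset.mem_product, Finset.mem_range] at he
    omega
  have hcard : (T.card : ℝ) ≤ n ^ 2 := by
    have := Finset.card_filter_le (Finset.range n ×ˢ Finset.range n) fun e => e.1 + B ≤ e.2
    rw [Finset.card_product, Finset.card_range, ← sq] at this
    exact_mod_cast this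
  calc (coinLaw r).real {ω | ∃ a b, a + B ≤ b ∧ b < n ∧ RightFail ω a b}
      ≤ (coinLaw r).real {ω | ∃ e ∈ T, RightFail ω e.1 e.2} :=
        measureReal_mono_coins r fun ω ⟨a, b, hab, hb, h⟩ => ⟨(a, b), by
          simp only [T, Finset.mem_filter, Finset.mem_product, Finset.mem_range]
          omega, h⟩
    _ ≤ T.card * (8 * n * Real.exp (-(p ^ 2 / 4)) ^ (B - 1)) := by
        refine (measureReal_exists_le_sum r T fun e ω => RightFail ω e.1 e.2).trans ?_
        rw [← nsmul_eq_mul]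
        refine Finset.sum_le_card_nsmul _ _ _ fun e he => ?_
        have := hT he
        exact (measureReal_rightFail_le hp0 hp1 hr (by omega) (by omega)).trans
          (failBound_le p (by omega) (by omega))
    _ ≤ _ := by gcongr

lemma measureReal_exists_leftFail_le (hp0 : 0 ≤ p) (hp1 : p ≤ 1) (hr : ∀ e, p ≤ r e) (B : ℕ) :
    (coinLaw r).real {ω | ∃ a, a + B < n ∧ LeftFail ω a} ≤
      n * (8 * n * Real.exp (-(p ^ 2 / 4)) ^ (B - 1)) := by
  calc (coinLaw r).real {ω | ∃ a, a + B < n ∧ LeftFail ω a}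
      ≤ (coinLaw r).real {ω | ∃ a ∈ Finset.range (n - B), LeftFail ω a} :=
        measureReal_mono_coins r fun ω ⟨a, ha, h⟩ => ⟨a, Finset.mem_range.mpr (by omega), h⟩
    _ ≤ (Finset.range (n - B)).card * (8 * n * Real.exp (-(p ^ 2 / 4)) ^ (B - 1)) := by
        refine (measureReal_exists_le_sum r _ fun a ω => LeftFail ω a).trans ?_
        rw [← nsmul_eq_mul]
        refine Finset.sum_le_card_nsmul _ _ _ fun a ha => ?_
        have := Finset.mem_range.mp ha
        exact (measureReal_leftFail_le hp0 hp1 hr a).trans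
          (failBound_le p (by omega) (by omega))
    _ ≤ _ := by
        rw [Finset.card_range]
        gcongr
        exact Nat.sub_le n B

end Segments

section Blocks

variable {n : ℕ} {ω : Config n} {s B v : ℕ}

/-- The edges in both directions between `v` and the next `s` vertices. -/
def star (n v s : ℕ) : Finset (Fin n × Fin n) :=
  seg n v (v + 1) ×ˢ seg n (v + 1) (v + 1 + s) ∪ seg n (v + 1) (v + 1 + s) ×ˢ seg n v (v + 1)

lemma star_subset (n v s : ℕ) : star n v s ⊆ seg n v (v + 1 + s) ×ˢ seg n v (v + 1 + s) := by
  intro e he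
  simp only [star, Finset.mem_union, Finset.mem_product, mem_seg] at he ⊢
  omega

lemma card_star_le (n v s : ℕ) : (star n v s).card ≤ 2 * s := by
  have hcentre := card_seg_le n v (v + 1)
  have hleaves := card_seg_le n (v + 1) (v + 1 + s)
  rw [Nat.add_sub_cancel_left] at hcentre hleaves
  calc (star n v s).card ≤ 1 * s + s * 1 := by
        refine (Finset.card_union_le _ _).trans ?_
        rw [Finset.card_product, Finset.card_product]
        gcongr
    _ = 2 * s := by ring

lemma mem_finalEdges_of_fan {c : Fin n}
    (h : ∀ x : Fin n, c < x → x.val < c.val + 1 + s → ω (c, x) = true) {x : Fin n} (hcx : c < x)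
    (hx : x.val < c.val + 1 + s) : (c, x) ∈ finalEdges ω := by
  induction hk : x.val - (c.val + 1) generalizing x with
  | zero => exact lineEdges_subset_finalEdges ω (mem_lineEdges.mpr (Or.inl (by simp only; omega)))
  | succ k ih =>
    let y : Fin n := ⟨x.val - 1, by omega⟩
    have hcy : (c, y) ∈ finalEdges ω :=
      ih (Fin.lt_def.mpr (by simp only [y]; omega)) (by simp only [y]; omega)
        (by simp only [y]; omega)
    exact mem_finalEdges_of_join hcx.ne (h x hcx hx) hcy
      (lineEdges_subset_finalEdges ω (mem_lineEdges.mpr (Or.inl (by simp only [y]; omega))))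

lemma saturated_of_star (hv : v < n) (h : ∀ e ∈ star n v s, ω e = true) :
    Saturated ω (seg n v (v + 1 + s)) := by
  let c : Fin n := ⟨v, hv⟩
  have hc {x : Fin n} (hcx : c < x) (hx : x.val < v + 1 + s) :
      (c, x) ∈ star n v s ∧ (x, c) ∈ star n v s := by
    have : v < x.val := hcx
    simp only [star, Finset.mem_union, Finset.mem_product, mem_seg, c]
    omega
  have hlt {x : Fin n} (hx : x ∈ seg n v (v + 1 + s)) (hxc : x ≠ c) : c < x :=
    lt_of_le_of_ne (mem_seg.mp hx).1 hxc.symm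
  have hout {x : Fin n} (hx : x ∈ seg n v (v + 1 + s)) (hxc : x ≠ c) : (c, x) ∈ finalEdges ω :=
    mem_finalEdges_of_fan (fun x hcx hx => h _ (hc hcx hx).1) (hlt hx hxc) (mem_seg.mp hx).2
  have hin {x : Fin n} (hx : x ∈ seg n v (v + 1 + s)) (hxc : x ≠ c) :
      (x, c) ∈ finalEdges ω := by
    have := mem_finalEdges_of_fan (ω := ω ∘ Prod.swap) (fun x hcx hx => h _ (hc hcx hx).2)
      (hlt hx hxc) (mem_seg.mp hx).2
    rwa [finalEdges_comp_swap] at this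
  rintro x hx y hy (hline | ⟨-, hxy, hopen⟩)
  · exact lineEdges_subset_finalEdges ω hline
  by_cases hxc : x = c
  · exact hxc ▸ hout hy fun hyc => hxy (hxc.trans hyc.symm)
  by_cases hyc : y = c
  · exact hyc ▸ hin hx hxc
  · exact mem_finalEdges_of_join hxy hopen (hin hx hxc) (hout hy hyc)

/-- The block of length `B` starting at `v` contains a nucleus that grows through the block. -/
def BlockGood (ω : Config n) (s B v : ℕ) : Prop :=
  (∀ e ∈ star n v s, ω e = true) ∧ ∀ d ∈ Finset.Ico (v + 1 + s) (v + B), ¬ RightFail ω v d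

lemma finalEdges_eq_of_blockGood (hs : s + 1 ≤ B) (hv : v + B ≤ n) (h : BlockGood ω s B v)
    (hright : ∀ b, v + B ≤ b → b < n → ¬ RightFail ω v b)
    (hleft : ∀ a, a + B < n → ¬ LeftFail ω a) :
    finalEdges ω = lineEdges n ∪ openEdges ω := by
  have hnucleus := saturated_of_star (by omega) h.1
  have hblock := hnucleus.grow_right (c := v + B) (by omega) (by omega) hv
    fun d hd hdB => h.2 d (Finset.mem_Ico.mpr ⟨hd, hdB⟩)
  have hsuffix := hblock.grow_right (by omega) hv le_rfl hright
  exact finalEdges_eq_of_saturated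
    (hsuffix.grow_left (by omega) fun d hd => hleft d (by omega))

lemma dependsOn_rightFail {a b : ℕ} (hab : a < b) :
    DependsOn (fun ω : Config n => RightFail ω a b)
      ((seg n a (b + 1) : Set (Fin n)) ×ˢ (seg n a (b + 1) : Set (Fin n))) := by
  refine fun ω ω' h => propext <| exists_congr fun u => exists_congr fun w =>
    and_congr_right fun hu => and_congr_right fun hw => Eq.to_iff ?_
  have hmem {x : Fin n} (hx : x ∈ insert w (seg n a b)) : x ∈ seg n a (b + 1) := by
    simp only [Finset.mem_insert, mem_seg] at hx ⊢
    rcases hx with rfl | hx <;> omega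
  exact dependsOn_stepFail (mem_seg.mpr (by omega)) w fun e he => h e ⟨hmem he.1, hmem he.2⟩

lemma dependsOn_blockGood (hs : s + 1 ≤ B) :
    DependsOn (fun ω : Config n => BlockGood ω s B v)
      ((seg n v (v + B) : Set (Fin n)) ×ˢ (seg n v (v + B) : Set (Fin n))) := by
  have hmono {c : ℕ} (hc : c ≤ v + B) {x : Fin n} (hx : x ∈ seg n v c) : x ∈ seg n v (v + B) :=
    mem_seg.mpr ⟨(mem_seg.mp hx).1, (mem_seg.mp hx).2.trans_le hc⟩
  intro ω ω' h
  refine congrArg₂ And (propext (forall₂_congr fun e he => ?_))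
    (propext (forall₂_congr fun d hd => not_congr (Eq.to_iff ?_)))
  · obtain ⟨h1, h2⟩ := Finset.mem_product.mp (star_subset n v s he)
    rw [h e ⟨hmono (by omega) h1, hmono (by omega) h2⟩]
  · have := Finset.mem_Ico.mp hd
    exact dependsOn_rightFail (by omega) fun e he =>
      h e ⟨hmono (by omega) he.1, hmono (by omega) he.2⟩

lemma pairwiseDisjoint_blocks (n B : ℕ) (T : Set ℕ) :
    T.PairwiseDisjoint fun i => (seg n (i * B) (i * B + B) : Set (Fin n)) ×ˢ
      (seg n (i * B) (i * B + B) : Set (Fin n)) := by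
  intro i _ j _ hij
  refine Set.disjoint_left.mpr fun e ⟨hi, _⟩ ⟨hj, _⟩ => hij ?_
  have hdiv {k : ℕ} (hk : e.1 ∈ seg n (k * B) (k * B + B)) : e.1.val / B = k :=
    Nat.div_eq_of_lt_le (mem_seg.mp hk).1 (by rw [add_one_mul]; exact (mem_seg.mp hk).2)
  rw [← hdiv hi, hdiv hj]

variable {r : Fin n × Fin n → unitInterval} {p : ℝ}

lemma half_le_measureReal_forall_not_rightFail (hp0 : 0 ≤ p) (hp1 : p ≤ 1) (hr : ∀ e, p ≤ r e)
    (hv : v + B ≤ n) (hsum : ∑ ℓ ∈ Finset.Ico s B, failBound p ℓ ≤ 1 / 2) :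
    1 / 2 ≤ (coinLaw r).real {ω | ∀ d ∈ Finset.Ico (v + 1 + s) (v + B), ¬ RightFail ω v d} := by
  have hreindex : ∑ d ∈ Finset.Ico (v + 1 + s) (v + B), failBound p (d - v - 1) ≤
      ∑ ℓ ∈ Finset.Ico s B, failBound p ℓ := by
    have hlen (i : ℕ) : v + 1 + s + i - v - 1 = s + i := by omega
    simp only [Finset.sum_Ico_eq_sum_range, hlen]
    exact Finset.sum_le_sum_of_subset_of_nonneg (Finset.range_subset_range.mpr (by omega))
      fun _ _ _ => failBound_nonneg _ _
  have hfail : (coinLaw r).real {ω | ∃ d ∈ Finset.Ico (v + 1 + s) (v + B), RightFail ω v d} ≤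
      1 / 2 :=
    calc _ ≤ ∑ d ∈ Finset.Ico (v + 1 + s) (v + B), failBound p (d - v - 1) :=
          (measureReal_exists_le_sum r _ fun d ω => RightFail ω v d).trans <|
            Finset.sum_le_sum fun d hd => by
              have := Finset.mem_Ico.mp hd
              exact measureReal_rightFail_le hp0 hp1 hr (by omega) (by omega)
      _ ≤ 1 / 2 := hreindex.trans hsum
  have hcompl : {ω : Config n | ∀ d ∈ Finset.Ico (v + 1 + s) (v + B), ¬ RightFail ω v d} =
      {ω | ∃ d ∈ Finset.Ico (v + 1 + s) (v + B), RightFail ω v d}ᶜ := by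
    ext
    simp
  rw [hcompl, probReal_compl_eq_one_sub (Set.toFinite _).measurableSet]
  linarith

lemma measureReal_not_blockGood_le (hp0 : 0 ≤ p) (hp1 : p ≤ 1) (hr : ∀ e, p ≤ r e)
    (hv : v + B ≤ n) (hsum : ∑ ℓ ∈ Finset.Ico s B, failBound p ℓ ≤ 1 / 2) :
    (coinLaw r).real {ω | ¬ BlockGood ω s B v} ≤ 1 - p ^ (2 * s) / 2 := by
  have hgrow := half_le_measureReal_forall_not_rightFail (s := s) (v := v)
    (r := fun e => if e ∈ star n v s then 1 else r e) hp0 hp1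
    (fun e => by split_ifs; exacts [hp1, hr e]) hv hsum
  have hstar : p ^ (2 * s) ≤ ∏ e ∈ star n v s, (r e : ℝ) :=
    calc p ^ (2 * s) ≤ p ^ (star n v s).card := pow_le_pow_of_le_one hp0 hp1 (card_star_le n v s)
      _ = ∏ _e ∈ star n v s, p := (Finset.prod_const p).symm
      _ ≤ _ := Finset.prod_le_prod (fun _ _ => hp0) fun e _ => hr e
  have hgood : p ^ (2 * s) * (1 / 2) ≤ (coinLaw r).real {ω | BlockGood ω s B v} := by
    simp only [BlockGood]
    rw [measureReal_forall_true_and]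
    exact mul_le_mul hstar hgrow (by norm_num) ((pow_nonneg hp0 _).trans hstar)
  have hcompl : {ω : Config n | ¬ BlockGood ω s B v} = {ω | BlockGood ω s B v}ᶜ := rfl
  rw [hcompl, probReal_compl_eq_one_sub (Set.toFinite _).measurableSet]
  linarith

lemma mul_add_le_of_mem_range (hB : B * B ≤ n) {i : ℕ} (hi : i ∈ Finset.range B) :
    i * B + B ≤ n := by
  rw [← add_one_mul]
  exact (Nat.mul_le_mul_right B (Finset.mem_range.mp hi)).trans hB

lemma measureReal_forall_not_blockGood_le (hp0 : 0 ≤ p) (hp1 : p ≤ 1) (hr : ∀ e, p ≤ r e)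
    (hs : s + 1 ≤ B) (hB : B * B ≤ n) (hsum : ∑ ℓ ∈ Finset.Ico s B, failBound p ℓ ≤ 1 / 2) :
    (coinLaw r).real {ω | ∀ i ∈ Finset.range B, ¬ BlockGood ω s B (i * B)} ≤
      (1 - p ^ (2 * s) / 2) ^ B := by
  have hdep : ∀ i ∈ Finset.range B, DependsOn (fun ω : Config n => ¬ BlockGood ω s B (i * B))
      ((seg n (i * B) (i * B + B) : Set (Fin n)) ×ˢ (seg n (i * B) (i * B + B) : Set (Fin n))) :=
    fun i _ ω ω' h => congrArg Not (dependsOn_blockGood hs h)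
  have := measureReal_forall_le_pow r (P := fun i ω => ¬ BlockGood ω s B (i * B))
    (Finset.range B) (pairwiseDisjoint_blocks n B _) hdep fun i hi =>
      measureReal_not_blockGood_le hp0 hp1 hr (mul_add_le_of_mem_range hB hi) hsum
  rwa [Finset.card_range] at this

lemma measureReal_not_saturated_le (hp0 : 0 ≤ p) (hp1 : p ≤ 1) (hr : ∀ e, p ≤ r e)
    (hs : s + 1 ≤ B) (hB : B * B ≤ n) (hsum : ∑ ℓ ∈ Finset.Ico s B, failBound p ℓ ≤ 1 / 2) :
    (coinLaw r).real {ω | finalEdges ω ≠ lineEdges n ∪ openEdges ω} ≤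
      (1 - p ^ (2 * s) / 2) ^ B +
        n * (n + 1) * (8 * n * Real.exp (-(p ^ 2 / 4)) ^ (B - 1)) := by
  have hsub (ω : Config n) (h : finalEdges ω ≠ lineEdges n ∪ openEdges ω) :
      (∀ i ∈ Finset.range B, ¬ BlockGood ω s B (i * B)) ∨
        (∃ a b, a + B ≤ b ∧ b < n ∧ RightFail ω a b) ∨ ∃ a, a + B < n ∧ LeftFail ω a := by
    by_contra! ⟨⟨i, hi, hgood⟩, hright, hleft⟩
    exact h (finalEdges_eq_of_blockGood hs (mul_add_le_of_mem_range hB hi) hgood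
      (hright _) hleft)
  calc _ ≤ (coinLaw r).real {ω | (∀ i ∈ Finset.range B, ¬ BlockGood ω s B (i * B)) ∨
        (∃ a b, a + B ≤ b ∧ b < n ∧ RightFail ω a b) ∨ ∃ a, a + B < n ∧ LeftFail ω a} :=
        measureReal_mono_coins r hsub
    _ ≤ (1 - p ^ (2 * s) / 2) ^ B +
          (n ^ 2 * (8 * n * Real.exp (-(p ^ 2 / 4)) ^ (B - 1)) +
            n * (8 * n * Real.exp (-(p ^ 2 / 4)) ^ (B - 1))) :=
        (measureReal_union_le _ _).trans <|
          add_le_add (measureReal_forall_not_blockGood_le hp0 hp1 hr hs hB hsum) <|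
            (measureReal_union_le _ _).trans <| add_le_add
              (measureReal_exists_rightFail_le hp0 hp1 hr (by omega))
              (measureReal_exists_leftFail_le hp0 hp1 hr B)
    _ = _ := by ring

end Blocks

/-! ### Asymptotics -/

lemma tendsto_log_natCast : Tendsto (fun n : ℕ => Real.log n) atTop atTop :=
  Real.tendsto_log_atTop.comp tendsto_natCast_atTop_atTop

lemma exp_neg_pow_le {b y : ℝ} {m : ℕ} (hb : 0 ≤ b) (h : y ≤ m + 1) :
    Real.exp (-b) ^ m ≤ Real.exp b * Real.exp (-(b * y)) := by
  rw [← Real.exp_nat_mul, ← Real.exp_add, Real.exp_le_exp]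
  nlinarith

lemma one_sub_pow_le_inv {x : ℝ} (hx0 : 0 < x) (hx1 : x ≤ 1) {m : ℕ} (hm : 0 < m) :
    (1 - x) ^ m ≤ (m * x)⁻¹ := by
  have hle : 1 - x ≤ Real.exp (-x) := by linarith [Real.add_one_le_exp (-x)]
  calc (1 - x) ^ m ≤ Real.exp (-x) ^ m := pow_le_pow_left₀ (sub_nonneg.mpr hx1) hle m
    _ = (Real.exp (m * x))⁻¹ := by rw [← Real.exp_nat_mul, mul_neg, Real.exp_neg]
    _ ≤ (m * x)⁻¹ := inv_anti₀ (by positivity) (by linarith [Real.add_one_le_exp (m * x)])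

section LogLengths

variable {α : ℝ}

lemma exp_neg_four_div_le_one (hα : 0 < α) : Real.exp (-(4 / α)) ≤ 1 :=
  Real.exp_le_one_iff.mpr (neg_nonpos.mpr (by positivity))

lemma mul_pow_half_floor_le (hα : 0 < α) {n : ℕ} (hn : 0 < n) :
    n * Real.exp (-(4 / α)) ^ (⌊α * Real.log n⌋₊ / 2) ≤
      Real.exp (4 / α) * Real.exp (-Real.log n) := by
  have hhalf : α * Real.log n / 2 ≤ (⌊α * Real.log n⌋₊ / 2 : ℕ) + 1 := by
    have h : (⌊α * Real.log n⌋₊ : ℝ) + 1 ≤ 2 * ((⌊α * Real.log n⌋₊ / 2 : ℕ) + 1) := by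
      exact_mod_cast (by omega)
    linarith [Nat.lt_floor_add_one (α * Real.log n)]
  calc n * Real.exp (-(4 / α)) ^ (⌊α * Real.log n⌋₊ / 2)
      ≤ n * (Real.exp (4 / α) * Real.exp (-(4 / α * (α * Real.log n / 2)))) := by
        gcongr
        exact exp_neg_pow_le (by positivity) hhalf
    _ = Real.exp (4 / α) * (Real.exp (Real.log n) * Real.exp (-(2 * Real.log n))) := by
        rw [Real.exp_log (by positivity)]
        field_simp
        ring_nf
    _ = Real.exp (4 / α) * Real.exp (-Real.log n) := by
        rw [← Real.exp_add]
        ring_nf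

lemma sq_mul_pow_floor_le (hα : 0 < α) {n : ℕ} (hn : 0 < n) :
    n ^ 2 * (2 * Real.exp (-(4 / α)) ^ ⌊α * Real.log n⌋₊) ≤
      2 * Real.exp (4 / α) * Real.exp (-Real.log n) := by
  have hlog : 0 ≤ Real.log n := Real.log_natCast_nonneg n
  calc n ^ 2 * (2 * Real.exp (-(4 / α)) ^ ⌊α * Real.log n⌋₊)
      ≤ n ^ 2 * (2 * (Real.exp (4 / α) * Real.exp (-(4 / α * (α * Real.log n))))) := by
        gcongr
        exact exp_neg_pow_le (by positivity) (Nat.lt_floor_add_one _).le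
    _ = 2 * Real.exp (4 / α) *
          (Real.exp (Real.log n) ^ 2 * Real.exp (-(4 * Real.log n))) := by
        rw [Real.exp_log (by positivity)]
        field_simp
    _ ≤ 2 * Real.exp (4 / α) * Real.exp (-Real.log n) := by
        rw [← Real.exp_nat_mul, ← Real.exp_add]
        gcongr
        push_cast
        linarith

/-- The constant `c`: at densities below `c / √(log n)` there are no edges longer than
`α * log n`. -/
noncomputable def lowConst (α : ℝ) : ℝ := Real.exp (-(4 / α)) / 2 / (2 * (α + 1))

lemma lowConst_pos (hα : 0 < α) : 0 < lowConst α := by rw [lowConst]; positivity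

lemma two_mul_lowConst_sq_le (hα : 0 < α) :
    2 * α * lowConst α ^ 2 ≤ (Real.exp (-(4 / α)) / 2) ^ 2 / 2 := by
  have h : Real.exp (-(4 / α)) / 2 = lowConst α * (2 * (α + 1)) := by
    rw [lowConst]
    field_simp
  rw [h]
  nlinarith [sq_nonneg (lowConst α), sq_nonneg (lowConst α * α)]

lemma eventually_low_density (hα : 0 < α) : ∀ᶠ n : ℕ in atTop,
    1 ≤ ⌊α * Real.log n⌋₊ ∧ lowConst α * (1 / √(Real.log n)) +
        (2 * ⌊α * Real.log n⌋₊ : ℕ) * (lowConst α * (1 / √(Real.log n))) ^ 2 ≤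
      (Real.exp (-(4 / α)) / 2) ^ 2 := by
  have hlim : Tendsto (fun n : ℕ => lowConst α * (1 / √(Real.log n))) atTop (𝓝 0) := by
    simpa [Function.comp_def] using (Real.tendsto_sqrt_atTop.comp
      tendsto_log_natCast).inv_tendsto_atTop.const_mul (lowConst α)
  filter_upwards [tendsto_log_natCast.eventually_gt_atTop 0,
    (tendsto_log_natCast.const_mul_atTop hα).eventually_ge_atTop 1,
    hlim.eventually_le_const (show 0 < (Real.exp (-(4 / α)) / 2) ^ 2 / 2 by positivity)]
    with n hlog hX hp
  refine ⟨Nat.one_le_floor_iff _ |>.mpr hX, ?_⟩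
  have hsq : (2 * ⌊α * Real.log n⌋₊ : ℕ) * (lowConst α * (1 / √(Real.log n))) ^ 2 ≤
      2 * α * lowConst α ^ 2 :=
    calc ((2 * ⌊α * Real.log n⌋₊ : ℕ) : ℝ) * (lowConst α * (1 / √(Real.log n))) ^ 2
        = 2 * ⌊α * Real.log n⌋₊ * (lowConst α ^ 2 / Real.log n) := by
          rw [mul_pow, div_pow, Real.sq_sqrt hlog.le]
          push_cast
          ring
      _ ≤ 2 * (α * Real.log n) * (lowConst α ^ 2 / Real.log n) := by
          gcongr
          exact Nat.floor_le (by positivity)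
      _ = 2 * α * lowConst α ^ 2 := by field_simp
  linarith [two_mul_lowConst_sq_le hα]

/-- The constant `A`: at rightward densities above `A` every open rightward edge longer than
`α * log n` is filled. -/
noncomputable def highConst (α : ℝ) : ℝ := 1 - (Real.exp (-(4 / α)) / 6) ^ 2

lemma highConst_pos (hα : 0 < α) : 0 < highConst α := by
  rw [highConst]
  nlinarith [exp_neg_four_div_le_one hα, Real.exp_pos (-(4 / α))]

lemma highConst_lt_one (α : ℝ) : highConst α < 1 := sub_lt_self 1 (by positivity)

end LogLengths

section GrowthRate

variable {p : ℝ}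

lemma failBound_le_geometric (hp : 0 < p) (ℓ : ℕ) :
    failBound p ℓ ≤ 8 / (p ^ 2 / 8) * Real.exp (-(p ^ 2 / 8)) ^ ℓ := by
  have hlin : p ^ 2 / 8 * ℓ * Real.exp (-(p ^ 2 / 8)) ^ ℓ ≤ 1 := by
    rw [← Real.exp_nat_mul, mul_neg, Real.exp_neg, ← div_eq_mul_inv, div_le_one (Real.exp_pos _),
      mul_comm (ℓ : ℝ)]
    linarith [Real.add_one_le_exp (p ^ 2 / 8 * ℓ)]
  have hsq : Real.exp (-(p ^ 2 / 4)) ^ ℓ =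
      Real.exp (-(p ^ 2 / 8)) ^ ℓ * Real.exp (-(p ^ 2 / 8)) ^ ℓ := by
    rw [← mul_pow, ← Real.exp_add]
    ring_nf
  rw [failBound, hsq, div_mul_eq_mul_div, le_div_iff₀ (by positivity)]
  have hpow : 0 ≤ Real.exp (-(p ^ 2 / 8)) ^ ℓ := by positivity
  nlinarith

lemma sum_failBound_le (hp0 : 0 < p) (hp1 : p ≤ 1) (s B : ℕ) :
    ∑ ℓ ∈ Finset.Ico s B, failBound p ℓ ≤
      16 / (p ^ 2 / 8) ^ 2 * Real.exp (-(p ^ 2 / 8 * s)) := by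
  set κ := p ^ 2 / 8 with hκ
  have hκ0 : 0 < κ := by positivity
  have hexp : Real.exp (-κ) ≤ 1 - κ / 2 := exp_neg_le_one_sub_half hκ0.le (by nlinarith)
  calc ∑ ℓ ∈ Finset.Ico s B, failBound p ℓ
      ≤ ∑ ℓ ∈ Finset.Ico s B, 8 / κ * Real.exp (-κ) ^ ℓ :=
        Finset.sum_le_sum fun ℓ _ => failBound_le_geometric hp0 ℓ
    _ ≤ 8 / κ * (Real.exp (-κ) ^ s / (1 - Real.exp (-κ))) := by
        rw [← Finset.mul_sum]
        gcongr
        exact geom_sum_Ico_le_of_lt_one (Real.exp_pos _).le (by linarith)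
    _ ≤ 8 / κ * (Real.exp (-κ) ^ s / (κ / 2)) := by
        gcongr
        linarith
    _ = 16 / κ ^ 2 * Real.exp (-(κ * s)) := by
        rw [← Real.exp_nat_mul, show (s : ℝ) * -κ = -(κ * s) by ring]
        field_simp
        norm_num

/-- The density `C * log (log n) / √(log n)` with `C = 20`, as a function of `L = log n`. -/
noncomputable def growthDensity (L : ℝ) : ℝ := 20 * (Real.log L / √L)

/-- The size of the initial stars from which saturated intervals grow, as a function of
`L = log n`. It is small enough that one of `√n` blocks contains such a star, and large enough that
growth from it rarely fails. -/
noncomputable def nucleusSize (L : ℝ) : ℕ := ⌊L / (4 * Real.log L)⌋₊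

variable {L : ℝ}

lemma growthDensity_pos (hL : 0 < L) (hlog : 1 ≤ Real.log L) : 0 < growthDensity L := by
  have : 0 < Real.log L := by linarith
  rw [growthDensity]
  positivity

lemma growthDensity_sq (hL : 0 < L) : growthDensity L ^ 2 = 400 * Real.log L ^ 2 / L := by
  rw [growthDensity, mul_pow, div_pow, Real.sq_sqrt hL.le]
  ring

lemma eight_div_le_growthDensity_sq (hL : 0 < L) (hlog : 1 ≤ Real.log L) :
    8 / L ≤ growthDensity L ^ 2 := by
  rw [growthDensity_sq hL]
  gcongr
  nlinarith

lemma nucleusSize_le (hL : 0 < L) (hlog : 1 ≤ Real.log L) :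
    nucleusSize L ≤ L / (4 * Real.log L) :=
  Nat.floor_le (by positivity)

lemma three_mul_log_le (hL : 0 < L) (hlog : 1 ≤ Real.log L) (hsq : 50 * Real.log L ^ 2 ≤ L) :
    3 * Real.log L ≤ growthDensity L ^ 2 / 8 * nucleusSize L := by
  have hfloor : L / (4 * Real.log L) - 1 ≤ nucleusSize L :=
    sub_le_iff_le_add.mpr (Nat.lt_floor_add_one _).le
  calc 3 * Real.log L ≤ 25 / 2 * Real.log L - 50 * Real.log L ^ 2 / L := by
        linarith [(div_le_one hL).mpr hsq]
    _ = growthDensity L ^ 2 / 8 * (L / (4 * Real.log L) - 1) := by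
        rw [growthDensity_sq hL]
        field_simp
        ring
    _ ≤ growthDensity L ^ 2 / 8 * nucleusSize L := by gcongr

lemma sum_failBound_growthDensity_le (hL : 32 ≤ L) (hlog : 1 ≤ Real.log L)
    (hsq : 50 * Real.log L ^ 2 ≤ L) (hp1 : growthDensity L ≤ 1) (B : ℕ) :
    ∑ ℓ ∈ Finset.Ico (nucleusSize L) B, failBound (growthDensity L) ℓ ≤ 1 / 2 := by
  have hL0 : 0 < L := by linarith
  have hκ : 1 / L ≤ growthDensity L ^ 2 / 8 := by
    linarith [eight_div_le_growthDensity_sq hL0 hlog, mul_one_div 8 L]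
  calc ∑ ℓ ∈ Finset.Ico (nucleusSize L) B, failBound (growthDensity L) ℓ
      ≤ 16 / (growthDensity L ^ 2 / 8) ^ 2 *
          Real.exp (-(growthDensity L ^ 2 / 8 * nucleusSize L)) :=
        sum_failBound_le (growthDensity_pos hL0 hlog) hp1 _ B
    _ ≤ 16 / (1 / L) ^ 2 * Real.exp (-(3 * Real.log L)) := by
        gcongr 16 / ?_ ^ 2 * Real.exp (-?_)
        exact three_mul_log_le hL0 hlog hsq
    _ = 16 / L := by
        rw [Real.exp_neg, mul_comm 3, Real.exp_mul, Real.exp_log hL0]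
        norm_cast
        field_simp
    _ ≤ 1 / 2 := by rw [div_le_div_iff₀ hL0 two_pos]; linarith

lemma exp_neg_le_growthDensity_pow (hL : 0 < L) (hlog : 1 ≤ Real.log L) :
    Real.exp (-(L / 4)) ≤ growthDensity L ^ (2 * nucleusSize L) := by
  have hinv : Real.exp (-Real.log L) ≤ growthDensity L ^ 2 := by
    rw [Real.exp_neg, Real.exp_log hL, inv_eq_one_div]
    exact le_trans (by gcongr; norm_num) (eight_div_le_growthDensity_sq hL hlog)
  have hsize : nucleusSize L * Real.log L ≤ L / 4 := by
    have := nucleusSize_le hL hlog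
    rw [le_div_iff₀ (by positivity)] at this
    linarith
  calc Real.exp (-(L / 4)) ≤ Real.exp (-Real.log L) ^ nucleusSize L := by
        rw [← Real.exp_nat_mul, Real.exp_le_exp]
        linarith
    _ ≤ (growthDensity L ^ 2) ^ nucleusSize L := by gcongr
    _ = growthDensity L ^ (2 * nucleusSize L) := (pow_mul _ 2 _).symm

lemma one_sub_growthDensity_pow_le (hL : 0 < L) (hlog : 1 ≤ Real.log L)
    (hp1 : growthDensity L ≤ 1) {B : ℕ} (hB : Real.exp (L / 2) ≤ 2 * B) :
    (1 - growthDensity L ^ (2 * nucleusSize L) / 2) ^ B ≤ 4 * Real.exp (-(L / 4)) := by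
  have hp0 := growthDensity_pos hL hlog
  have hpow : growthDensity L ^ (2 * nucleusSize L) ≤ 1 := pow_le_one₀ hp0.le hp1
  have hB0 : (0 : ℝ) < B := by linarith [Real.exp_pos (L / 2)]
  refine (one_sub_pow_le_inv (by positivity) (by linarith) (by exact_mod_cast hB0)).trans ?_
  calc (B * (growthDensity L ^ (2 * nucleusSize L) / 2))⁻¹
      ≤ (Real.exp (L / 2) / 2 * (Real.exp (-(L / 4)) / 2))⁻¹ := by
        gcongr
        · linarith
        · exact exp_neg_le_growthDensity_pow hL hlog
    _ = 4 * Real.exp (-(L / 4)) := by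
        rw [div_mul_div_comm, ← Real.exp_add, inv_div, div_eq_mul_inv, ← Real.exp_neg]
        ring_nf

lemma exp_neg_growthDensity_pow_le (hL : 0 < L) (hlog : 1 ≤ Real.log L) {m : ℕ}
    (hm : 4 * L ^ 2 ≤ m) :
    Real.exp (-(growthDensity L ^ 2 / 4)) ^ m ≤ Real.exp (-(4 * L)) := by
  have hκ : 1 / L ≤ growthDensity L ^ 2 / 4 := by
    have : 0 < 1 / L := by positivity
    linarith [eight_div_le_growthDensity_sq hL hlog, mul_one_div 8 L]
  rw [← Real.exp_nat_mul, Real.exp_le_exp, mul_neg, neg_le_neg_iff]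
  calc 4 * L = 4 * L ^ 2 * (1 / L) := by field_simp
    _ ≤ m * (growthDensity L ^ 2 / 4) := by gcongr

end GrowthRate

lemma exp_half_log_le_sqrt_add_one {n : ℕ} (hn : 0 < n) :
    Real.exp (Real.log n / 2) ≤ Nat.sqrt n + 1 := by
  rw [Real.exp_half, Real.exp_log (by positivity)]
  exact Real.real_sqrt_le_nat_sqrt_succ

lemma measureReal_not_saturated_le_exp {n : ℕ} {r : Fin n × Fin n → unitInterval}
    (hr : ∀ e, growthDensity (Real.log n) ≤ r e) (hp1 : growthDensity (Real.log n) ≤ 1)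
    (hL : 32 ≤ Real.log n) (hlog : 1 ≤ Real.log (Real.log n))
    (hsq : 50 * Real.log (Real.log n) ^ 2 ≤ Real.log n)
    (hbig : 4 * Real.log n ^ 2 + 2 ≤ Real.exp (Real.log n / 2)) :
    (coinLaw r).real {ω | finalEdges ω ≠ lineEdges n ∪ openEdges ω} ≤
      4 * Real.exp (-(Real.log n / 4)) + 16 * Real.exp (-Real.log n) := by
  have hn : 0 < n := Nat.pos_of_ne_zero fun h => by norm_num [h] at hL
  set L := Real.log n
  have hL0 : 0 < L := by linarith
  have hB := exp_half_log_le_sqrt_add_one hn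
  have hs : nucleusSize L + 1 ≤ n.sqrt := by
    have hsL : nucleusSize L ≤ L := (nucleusSize_le hL0 hlog).trans
      (div_le_self hL0.le (by linarith))
    exact_mod_cast (by nlinarith : (nucleusSize L : ℝ) + 1 ≤ n.sqrt)
  have hB1 : 4 * L ^ 2 ≤ (n.sqrt - 1 : ℕ) := by
    rw [Nat.cast_pred (by omega)]
    linarith
  have hn1 : (1 : ℝ) ≤ n := by exact_mod_cast hn
  calc _ ≤ (1 - growthDensity L ^ (2 * nucleusSize L) / 2) ^ n.sqrt +
        n * (n + 1) * (8 * n * Real.exp (-(growthDensity L ^ 2 / 4)) ^ (n.sqrt - 1)) :=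
        measureReal_not_saturated_le (growthDensity_pos hL0 hlog).le hp1 hr hs (Nat.sqrt_le n)
          (sum_failBound_growthDensity_le hL hlog hsq hp1 _)
    _ ≤ 4 * Real.exp (-(L / 4)) + n * (n + n) * (8 * n * Real.exp (-(4 * L))) := by
        gcongr
        · exact one_sub_growthDensity_pow_le hL0 hlog hp1 (by nlinarith)
        · exact exp_neg_growthDensity_pow_le hL0 hlog hB1
    _ = 4 * Real.exp (-(L / 4)) + 16 * (Real.exp L ^ 3 * Real.exp (-(4 * L))) := by
        rw [Real.exp_log (by positivity)]
        ring
    _ = 4 * Real.exp (-(L / 4)) + 16 * Real.exp (-L) := by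
        rw [← Real.exp_nat_mul, ← Real.exp_add]
        ring_nf

lemma eventually_mul_log_sq_le : ∀ᶠ x : ℝ in atTop, 50 * Real.log x ^ 2 ≤ x := by
  have h := (Real.isLittleO_pow_log_id_atTop (n := 2)).bound (show (0 : ℝ) < 1 / 50 by norm_num)
  filter_upwards [h, eventually_ge_atTop 0] with x hx hx0
  rw [Real.norm_of_nonneg (by positivity), id, Real.norm_of_nonneg hx0] at hx
  linarith

lemma eventually_mul_sq_add_two_le_exp_half :
    ∀ᶠ x : ℝ in atTop, 4 * x ^ 2 + 2 ≤ Real.exp (x / 2) := by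
  filter_upwards [eventually_ge_atTop 400] with x hx
  have h := Real.pow_div_factorial_le_exp (x / 2) (by linarith) 3
  norm_num [Nat.factorial] at h
  nlinarith

section AAS

variable {pleft pright : ℕ → unitInterval}

lemma aas_iff_tendsto_compl {Ev : ∀ n : ℕ, Set (Config n)} : AAS pleft pright Ev ↔
    Tendsto (fun n => (coinLaw (edgeProb (pleft n) (pright n))).real (Ev n)ᶜ) atTop (𝓝 0) := by
  have hreal : AAS pleft pright Ev ↔
      Tendsto (fun n => (coinLaw (edgeProb (pleft n) (pright n))).real (Ev n)) atTop (𝓝 1) :=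
    (ENNReal.tendsto_toReal_iff (fun n => measure_ne_top (coinLaw _) _) ENNReal.one_ne_top).symm
  simp only [hreal, probReal_compl_eq_one_sub (Set.toFinite _).measurableSet]
  exact ⟨fun h => by simpa using h.const_sub 1, fun h => by simpa using h.const_sub 1⟩

lemma aas_of_compl_le {Ev : ∀ n : ℕ, Set (Config n)} {u : ℕ → ℝ} (hu : Tendsto u atTop (𝓝 0))
    (h : ∀ᶠ n in atTop, (coinLaw (edgeProb (pleft n) (pright n))).real (Ev n)ᶜ ≤ u n) :
    AAS pleft pright Ev :=
  aas_iff_tendsto_compl.mpr <|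
    squeeze_zero' (.of_forall fun _ => measureReal_nonneg) h hu

lemma AAS.inter {Ev Ev' : ∀ n : ℕ, Set (Config n)} (h : AAS pleft pright Ev)
    (h' : AAS pleft pright Ev') : AAS pleft pright fun n => Ev n ∩ Ev' n := by
  have hlim := (aas_iff_tendsto_compl.mp h).add (aas_iff_tendsto_compl.mp h')
  refine aas_of_compl_le (by simpa only [add_zero] using hlim) (.of_forall fun n => ?_)
  rw [Set.compl_inter]
  exact measureReal_union_le _ _

lemma AAS.mono {Ev Ev' : ∀ n : ℕ, Set (Config n)} (h : AAS pleft pright Ev)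
    (hsub : ∀ n, Ev n ⊆ Ev' n) : AAS pleft pright Ev' :=
  aas_of_compl_le (aas_iff_tendsto_compl.mp h) <| .of_forall fun n =>
    measureReal_mono (Set.compl_subset_compl.mpr (hsub n))

lemma edgeProb_of_isLeftward {n : ℕ} {pl pr : unitInterval} {e : Fin n × Fin n}
    (h : IsLeftward e) : edgeProb pl pr e = pl :=
  if_neg h.not_gt

lemma edgeProb_of_isRightward {n : ℕ} {pl pr : unitInterval} {e : Fin n × Fin n}
    (h : IsRightward e) : edgeProb pl pr e = pr :=
  if_pos h

lemma min_le_edgeProb {n : ℕ} (pl pr : unitInterval) (e : Fin n × Fin n) :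
    min (pl : ℝ) pr ≤ edgeProb pl pr e := by
  rw [edgeProb]
  split_ifs
  exacts [min_le_right _ _, min_le_left _ _]

lemma tendsto_mul_exp_neg_log (K : ℝ) :
    Tendsto (fun n : ℕ => K * Real.exp (-Real.log n)) atTop (𝓝 0) := by
  simpa using (Real.tendsto_exp_neg_atTop_nhds_zero.comp tendsto_log_natCast).const_mul K

variable {α : ℝ}

lemma floor_mul_log_lt_iff (hα : 0 < α) (n m : ℕ) :
    ⌊α * Real.log n⌋₊ < m ↔ α * Real.log n < m :=
  Nat.floor_lt (mul_nonneg hα.le (Real.log_natCast_nonneg n))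

lemma aas_no_long_leftward (hα : 0 < α)
    (h : ∀ᶠ n : ℕ in atTop, (pleft n : ℝ) < lowConst α * (1 / √(Real.log n))) :
    AAS pleft pright fun n =>
      {ω | ∀ e ∈ finalEdges ω, IsLeftward e → ¬ α * Real.log n < (edgeLength e : ℝ)} := by
  refine aas_of_compl_le (tendsto_mul_exp_neg_log (Real.exp (4 / α))) ?_
  filter_upwards [h, eventually_low_density hα, eventually_gt_atTop 0] with n hp ⟨hX, hη⟩ hn
  refine le_trans (measureReal_mono_coins _ fun ω hω => ?_) <|
    (measureReal_exists_long_leftward_le (fun e he => ?_) (by positivity [lowConst_pos hα])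
      (by positivity) (by linarith [exp_neg_four_div_le_one hα]) hX hη).trans ?_
  · simp only [Set.mem_ofPred_eq, not_forall, not_not] at hω
    simpa only [floor_mul_log_lt_iff hα, exists_prop] using hω
  · exact (edgeProb_of_isLeftward he).symm ▸ hp.le
  · rw [mul_div_cancel₀ _ two_ne_zero]
    exact mul_pow_half_floor_le hα hn

lemma aas_no_long_rightward (hα : 0 < α)
    (h : ∀ᶠ n : ℕ in atTop, (pright n : ℝ) < lowConst α * (1 / √(Real.log n))) :
    AAS pleft pright fun n =>
      {ω | ∀ e ∈ finalEdges ω, IsRightward e → ¬ α * Real.log n < (edgeLength e : ℝ)} := by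
  refine aas_of_compl_le (tendsto_mul_exp_neg_log (Real.exp (4 / α))) ?_
  filter_upwards [h, eventually_low_density hα, eventually_gt_atTop 0] with n hp ⟨hX, hη⟩ hn
  refine le_trans (measureReal_mono_coins _ fun ω hω => ?_) <|
    (measureReal_exists_long_rightward_le (fun e he => ?_) (by positivity [lowConst_pos hα])
      (by positivity) (by linarith [exp_neg_four_div_le_one hα]) hX hη).trans ?_
  · simp only [Set.mem_ofPred_eq, not_forall, not_not] at hω
    simpa only [floor_mul_log_lt_iff hα, exists_prop] using hω
  · exact (edgeProb_of_isRightward he).symm ▸ hp.le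
  · rw [mul_div_cancel₀ _ two_ne_zero]
    exact mul_pow_half_floor_le hα hn

lemma aas_long_open_rightward_mem (hα : 0 < α)
    (h : ∀ᶠ n : ℕ in atTop, highConst α < (pright n : ℝ)) :
    AAS pleft pright fun n => {ω | ∀ e ∈ openEdges ω, IsRightward e →
      α * Real.log n < (edgeLength e : ℝ) → e ∈ finalEdges ω} := by
  refine aas_of_compl_le (tendsto_mul_exp_neg_log (2 * Real.exp (4 / α))) ?_
  filter_upwards [h, eventually_gt_atTop 0] with n hp hn
  refine le_trans (measureReal_mono_coins _ fun ω hω => ?_) <|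
    (measureReal_exists_long_open_rightward_notMem_le (s := Real.exp (-(4 / α)) / 6)
      (by positivity) (by linarith [exp_neg_four_div_le_one hα]) (fun e he => ?_)
      ⌊α * Real.log n⌋₊).trans ?_
  · simp only [Set.mem_ofPred_eq, not_forall] at hω
    simpa only [floor_mul_log_lt_iff hα, exists_prop] using hω
  · rw [highConst] at hp
    rw [edgeProb_of_isRightward he]
    linarith
  · rw [mul_div_cancel₀ _ (by norm_num : (6 : ℝ) ≠ 0)]
    exact sq_mul_pow_floor_le hα hn

lemma aas_saturated
    (h : ∀ᶠ n : ℕ in atTop, growthDensity (Real.log n) < min (pleft n : ℝ) (pright n : ℝ)) :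
    AAS pleft pright fun n => {ω | finalEdges ω = lineEdges n ∪ openEdges ω} := by
  have hlim : Tendsto (fun n : ℕ => 4 * Real.exp (-(Real.log n / 4)) +
      16 * Real.exp (-Real.log n)) atTop (𝓝 0) := by
    simpa using ((Real.tendsto_exp_neg_atTop_nhds_zero.comp
      (tendsto_log_natCast.atTop_div_const four_pos)).const_mul 4).add (tendsto_mul_exp_neg_log 16)
  refine aas_of_compl_le hlim ?_
  filter_upwards [h, tendsto_log_natCast.eventually_ge_atTop 32,
    (Real.tendsto_log_atTop.comp tendsto_log_natCast).eventually_ge_atTop 1,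
    tendsto_log_natCast.eventually eventually_mul_log_sq_le,
    tendsto_log_natCast.eventually eventually_mul_sq_add_two_le_exp_half]
    with n hp hL hlog hsq hbig
  exact measureReal_not_saturated_le_exp (fun e => hp.le.trans (min_le_edgeProb _ _ e))
    ((hp.trans_le (min_le_left _ _)).le.trans unitInterval.le_one') hL hlog hsq hbig

end AAS

end TransClosure

theorem theorem2 (α : ℝ) (hα : 0 < α) :
    ∃ c C A : ℝ, 0 < c ∧ 0 < C ∧ 0 < A ∧ A < 1 ∧
      ∀ pleft pright : ℕ → unitInterval,
        ((∀ᶠ n : ℕ in Filter.atTop,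
            max (pleft n : ℝ) (pright n : ℝ) < c * (1 / √(Real.log n))) →
          TransClosure.AAS pleft pright fun n =>
            {ω | ∀ e ∈ TransClosure.finalEdges ω,
              ¬ α * Real.log n < (TransClosure.edgeLength e : ℝ)}) ∧
        ((∀ᶠ n : ℕ in Filter.atTop,
            (pleft n : ℝ) < c * (1 / √(Real.log n)) ∧ A < (pright n : ℝ)) →
          TransClosure.AAS pleft pright fun n =>
            {ω |
              (∀ e ∈ TransClosure.openEdges ω, TransClosure.IsRightward e →
                α * Real.log n < (TransClosure.edgeLength e : ℝ) →
                e ∈ TransClosure.finalEdges ω) ∧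
              (∀ e ∈ TransClosure.finalEdges ω, TransClosure.IsLeftward e →
                ¬ α * Real.log n < (TransClosure.edgeLength e : ℝ))}) ∧
        ((∀ᶠ n : ℕ in Filter.atTop,
            C * (Real.log (Real.log n) / √(Real.log n)) <
              min (pleft n : ℝ) (pright n : ℝ)) →
          TransClosure.AAS pleft pright fun n =>
            {ω | TransClosure.finalEdges ω =
              TransClosure.lineEdges n ∪ TransClosure.openEdges ω}) := by
  open TransClosure in
  refine ⟨lowConst α, 20, highConst α, lowConst_pos hα, by norm_num, highConst_pos hα,
    highConst_lt_one α, fun pleft pright => ⟨fun h => ?_, fun h => ?_, aas_saturated⟩⟩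
  · have hleft := aas_no_long_leftward (pright := pright) hα <|
      h.mono fun n hn => (le_max_left _ _).trans_lt hn
    have hright := aas_no_long_rightward (pleft := pleft) hα <|
      h.mono fun n hn => (le_max_right _ _).trans_lt hn
    refine (hleft.inter hright).mono fun n ω ⟨hl, hr⟩ e he hlen => ?_
    rcases lt_trichotomy e.1 e.2 with hlt | heq | hgt
    · exact hr e he hlt hlen
    · have hnonneg := mul_nonneg hα.le (Real.log_natCast_nonneg n)
      rw [edgeLength, heq, SimpleGraph.dist_self, Nat.cast_zero] at hlen
      exact hnonneg.not_gt hlen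
    · exact hl e he hgt hlen
  · exact (aas_long_open_rightward_mem hα (h.mono fun n hn => hn.2)).inter
      (aas_no_long_leftward hα (h.mono fun n hn => hn.1))
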